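/- Let $\mathbb F$ be a field. A *divided power algebra* is a commutative associative non-unital $\mathbb F$-algebra $A$ with operations $a\mapsto a^{[n]}$ ($n\ge 1$) such that $(\lambda a)^{[n]}=\lambda^na^{[n]}$, $a^{[m]}a^{[n]}=\binom{m+n}{m}a^{[m+n]}$, $(a+b)^{[n]}=a^{[n]}+\sum_{l=1}^{n-1}a^{[l]}b^{[n-l]}+b^{[n]}$, $a^{[1]}=a$, $(ab)^{[n]}=n!\,a^{[n]}b^{[n]}=a^nb^{[n]}=a^{[n]}b^n$ and $(a^{[n]})^{[m]}=\frac{(mn)!}{m!(n!)^m}a^{[mn]}$; morphisms are the algebra maps commuting with all $(-)^{[n]}$. Let $U(A)$ be the underlying commutative algebra of $A$. For a $U(A)$-module $M$ (an $\mathbb F$-vector space with an $\mathbb F$-bilinear action satisfying $(ab)\cdot m=a\cdot(b\cdot m)$), let $A\ltimes_pM$ (with trivial $p$-map) be the divided power algebra on $A\oplus M$ with $$(a,m)(b,n)=(ab,\,a\cdot n+b\cdot m),\qquad (a,m)^{[1]}=(a,m),\qquad (a,m)^{[n]}=(a^{[n]},\,a^{[n-1]}\cdot m)\quad(n\ge 2);$$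 if $\mathbb F$ has characteristic $p>0$, then in particular $(a,m)^{[p]}=(a^{[p]},-a^{p-1}\cdot m)$. The *algebraic tangent structure* is the Rosický tangent structure on the category of divided power algebras with $\mathsf TA=A\ltimes_pA$, $\mathsf T f=f\times f$, projection $p(a,b)=a$, sum $s(a,b,c)=(a,b+c)$, zero $z(a)=(a,0)$, vertical lift $l(a,b)=(a,0,0,b)$, canonical flip $c(a,b,c,d)=(a,c,b,d)$ and negative $n(a,b)=(a,-b)$. A *differential bundle* over $A$ is a morphism $q:E\to A$ whose finite fibre powers over $A$ exist and are preserved by all $\mathsf T^m$, with the structure $(\sigma:E\times_AE\to E,\ \zeta:A\to E)$ of a commutative monoid in the slice category over $A$, and with a lift $\lambda:E\to\mathsf TE$ such that $(\lambda,z_A):(q,\sigma,\zeta)\to(\mathsf Tq,\mathsf T\sigma,\mathsf T\zeta)$ and $(\lambda,\zeta):(q,\sigma,\zeta)\to(p_E,s_E,z_E)$ are morphisms of additive bundles, $\mathsf T(\lambda)\circ\lambda=l_E\circ\lambda$, and the square with sides $\mathsf T(\sigma)\circ\langle\lambda\circ\pi_1,z_E\circ\pi_2\rangle:E\times_AE\to\mathsf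 TE$, $q\circ\pi_1:E\times_AE\to A$, $\mathsf Tq:\mathsf TE\to\mathsf TA$ and $z_A:A\to\mathsf TA$ is a pullback preserved by all $\mathsf T^m$. Let $\mathsf{DBun}_A$ be the category of differential bundles over $A$, with as morphisms $E\to E'$ the morphisms $f$ of divided power algebras such that $q'\circ f=q$ and $\lambda'\circ f=\mathsf T(f)\circ\lambda$. **Theorem.** For every divided power algebra $A$, the functors $$\ker:\mathsf{DBun}_A\rightleftarrows U(A)_{\mathsf{Mod}}:A\ltimes_p-$$ form an equivalence of categories. Here $\ker$ sends a differential bundle $q:E\to A$ to the $U(A)$-module $\ker(q)$ with the action $a\cdot k=\zeta(a)k$, and a morphism to its restriction; $A\ltimes_p-$ sends $M$ to $A\ltimes_pM$ (with trivial $p$-map) with $q(a,m)=a$, $\sigma(a,m,m')=(a,m+m')$, $\zeta(a)=(a,0)$ and $\lambda(a,m)=(a,0,0,m)$, and $g:M\to N$ to $(a,m)\mapsto(a,g(m))$. -/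

import Mathlib

open CategoryTheory CategoryTheory.Limits
open scoped Nat

universe v u

noncomputable section

/-! ### Tangent structures and differential bundles -/

section Tangent

universe v₁ u₁

variable {C : Type u₁} [Category.{v₁} C]

/-- The iterates `T^m` of an endofunctor. -/
def iterFunctor (T : C ⥤ C) : ℕ → (C ⥤ C)
  | 0 => 𝟭 C
  | n + 1 => iterFunctor T n ⋙ T

/-- For every `n`, the `n`-fold pullback of `q` along itself exists, and it is preserved by all the
iterates of `T`. -/
structure HasFiberPowers (T : C ⥤ C) {E A : C} (q : E ⟶ A) : Prop where
  hasWidePullback : ∀ n : ℕ, HasWidePullback A (fun _ : Fin n => E) (fun _ => q)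
  preserved : ∀ m n : ℕ, PreservesLimit
    (WidePullbackShape.wideCospan A (fun _ : Fin n => E) (fun _ => q)) (iterFunctor T m)

theorem HasFiberPowers.map_isPullback {T : C ⥤ C} {E A : C} {q : E ⟶ A} (h : HasFiberPowers T q)
    {P : C} {a b : P ⟶ E} (sq : IsPullback a b q q) :
    IsPullback (T.map a) (T.map b) (T.map q) (T.map q) := by
  have h1 : PreservesLimit (WidePullbackShape.wideCospan A (fun _ : Fin 2 => E) (fun _ => q)) T :=
    h.preserved 1 2
  let c : WidePullbackCone (fun _ : Fin 2 => q) :=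
    WidePullbackCone.mk (a ≫ q) (fun i => if i = 0 then a else b) (fun i => by
      split_ifs
      · rfl
      · exact sq.w.symm)
  have c0 : c.π 0 = a := rfl
  have c1 : c.π 1 = b := rfl
  have hc : IsLimit c := WidePullbackCone.IsLimit.mk c
    (fun t => sq.lift (t.π 0) (t.π 1) (by rw [t.condition, t.condition]))
    (fun t => by
      change _ ≫ a ≫ q = _
      rw [sq.lift_fst_assoc, t.condition])
    (fun t i => by
      fin_cases i
      · exact sq.lift_fst _ _ _
      · exact sq.lift_snd _ _ _)
    (fun t m _ hm => by
      apply sq.hom_ext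
      · rw [sq.lift_fst]; exact hm 0
      · rw [sq.lift_snd]; exact hm 1)
  have hT := isLimitOfPreserves T hc
  let k (s : PullbackCone (T.map q) (T.map q)) :
      Cone (WidePullbackShape.wideCospan A (fun _ : Fin 2 => E) (fun _ => q) ⋙ T) :=
    WidePullbackShape.mkCone (s.fst ≫ T.map q) (fun i => if i = 0 then s.fst else s.snd) (fun i => by
      fin_cases i
      · rfl
      · exact s.condition.symm)
  refine ⟨⟨by rw [← T.map_comp, ← T.map_comp, sq.w]⟩, ⟨PullbackCone.IsLimit.mk _
    (fun s => hT.lift (k s)) (fun s => hT.fac (k s) (some 0)) (fun s => hT.fac (k s) (some 1)) ?_⟩⟩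
  intro s m hm0 hm1
  refine hT.uniq (k s) m fun j => ?_
  rcases j with _ | i
  · change m ≫ T.map (a ≫ q) = s.fst ≫ T.map q
    rw [T.map_comp, ← hm0, Category.assoc]
  · fin_cases i
    · exact hm0
    · exact hm1

/-- The data of an additive bundle structure on `q : E ⟶ A`: a pullback `pow₂` of `q` along
itself, an addition and a zero. -/
structure AdditiveData {E A : C} (q : E ⟶ A) where
  pow₂ : C
  fst : pow₂ ⟶ E
  snd : pow₂ ⟶ E
  sq : IsPullback fst snd q q
  add : pow₂ ⟶ E
  zero : A ⟶ E

namespace AdditiveData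

variable {E A E' A' : C} {q : E ⟶ A} {q' : E' ⟶ A'}

/-- The sum of two generalised elements lying over the same generalised element of `A`. -/
def sum (B : AdditiveData q) {X : C} (x y : X ⟶ E) (h : x ≫ q = y ≫ q) : X ⟶ E :=
  B.sq.lift x y h ≫ B.add

/-- The image under `T`. -/
def map (B : AdditiveData q) (T : C ⥤ C) (h : HasFiberPowers T q) : AdditiveData (T.map q) where
  pow₂ := T.obj B.pow₂
  fst := T.map B.fst
  snd := T.map B.snd
  sq := h.map_isPullback B.sq
  add := T.map B.add
  zero := T.map B.zero

/-- The addition and the zero make `q` a commutative monoid in the slice category over `A`. -/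
structure IsAdditiveBundle (B : AdditiveData q) : Prop where
  add_proj : B.add ≫ q = B.fst ≫ q
  zero_proj : B.zero ≫ q = 𝟙 A
  sum_assoc : ∀ ⦃X : C⦄ (x y z : X ⟶ E) (hxy : x ≫ q = y ≫ q) (hyz : y ≫ q = z ≫ q),
    B.sum (B.sum x y hxy) z (by
        rw [sum, Category.assoc, add_proj, B.sq.lift_fst_assoc, hxy, hyz]) =
      B.sum x (B.sum y z hyz) (by
        rw [sum, Category.assoc, add_proj, B.sq.lift_fst_assoc, hxy])
  sum_comm : ∀ ⦃X : C⦄ (x y : X ⟶ E) (hxy : x ≫ q = y ≫ q), B.sum x y hxy = B.sum y x hxy.symm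
  zero_sum : ∀ ⦃X : C⦄ (x : X ⟶ E),
    B.sum (x ≫ q ≫ B.zero) x (by simp only [Category.assoc, zero_proj, Category.comp_id]) = x

/-- `(f, g)` is a morphism of additive bundles from `q : E ⟶ A` to `q' : E' ⟶ A'`. -/
structure IsAdditiveMap (B : AdditiveData q) (B' : AdditiveData q') (f : E ⟶ E') (g : A ⟶ A') :
    Prop where
  proj : f ≫ q' = q ≫ g
  zero : B.zero ≫ f = g ≫ B'.zero
  add : B.add ≫ f = B'.sum (B.fst ≫ f) (B.snd ≫ f) (by
    rw [Category.assoc, Category.assoc, proj, ← Category.assoc, ← Category.assoc, B.sq.w])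

/-- Universality of a vertical lift `lam : E ⟶ T E`, where `zA` and `zE` are the zero maps of the
tangent bundles of `A` and `E`: with `μ = ⟨π₁ ≫ lam, π₂ ≫ zE⟩ ≫ T(add)`, the square
```
  E₂ ----μ----> T E
  |              |
  A ----zA----> T A
```
is a pullback, preserved by all the iterates of `T`. -/
structure IsUniversalLift (B : AdditiveData q) (T : C ⥤ C) (h : HasFiberPowers T q)
    (zA : A ⟶ T.obj A) (zE : E ⟶ T.obj E) (lam : E ⟶ T.obj E) : Prop where
  comm : (B.fst ≫ lam) ≫ T.map q = (B.snd ≫ zE) ≫ T.map q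
  isPullback : ∀ m : ℕ, IsPullback ((iterFunctor T m).map (B.fst ≫ q))
    ((iterFunctor T m).map ((B.map T h).sum (B.fst ≫ lam) (B.snd ≫ zE) comm))
    ((iterFunctor T m).map zA) ((iterFunctor T m).map (T.map q))

end AdditiveData

variable (C) in
/-- A Rosický tangent structure. The sum `s_A : T₂ A ⟶ T A` and the zero `z_A : A ⟶ T A` are the
structure maps of `bundle A`; their naturality is `map_additive`. -/
structure TangentStructure where
  T : C ⥤ C
  p : T ⟶ 𝟭 C
  powers : ∀ A, HasFiberPowers T (p.app A)
  bundle : ∀ A, AdditiveData (p.app A)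
  isAdditiveBundle : ∀ A, (bundle A).IsAdditiveBundle
  map_additive : ∀ ⦃A B : C⦄ (f : A ⟶ B), (bundle A).IsAdditiveMap (bundle B) (T.map f) f
  lift : T ⟶ T ⋙ T
  flip : T ⋙ T ⟶ T ⋙ T
  neg : T ⟶ T
  lift_additive : ∀ A,
    (bundle A).IsAdditiveMap ((bundle A).map T (powers A)) (lift.app A) (bundle A).zero
  flip_additive : ∀ A,
    ((bundle A).map T (powers A)).IsAdditiveMap (bundle (T.obj A)) (flip.app A) (𝟙 (T.obj A))
  lift_lift : ∀ A, lift.app A ≫ T.map (lift.app A) = lift.app A ≫ lift.app (T.obj A)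
  flip_flip : ∀ A, flip.app A ≫ flip.app A = 𝟙 (T.obj (T.obj A))
  lift_flip : ∀ A, lift.app A ≫ flip.app A = lift.app A
  flip_hexagon : ∀ A, T.map (flip.app A) ≫ flip.app (T.obj A) ≫ T.map (flip.app A) =
    flip.app (T.obj A) ≫ T.map (flip.app A) ≫ flip.app (T.obj A)
  lift_flip_flip : ∀ A, lift.app (T.obj A) ≫ T.map (flip.app A) ≫ flip.app (T.obj A) =
    flip.app A ≫ T.map (lift.app A)
  universal : ∀ A, (bundle A).IsUniversalLift T (powers A) (bundle A).zero
    (bundle (T.obj A)).zero (lift.app A)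
  neg_proj : ∀ A, neg.app A ≫ p.app A = p.app A
  neg_add : ∀ A, (bundle A).sum (neg.app A) (𝟙 (T.obj A)) (by
    rw [neg_proj]; exact (Category.id_comp _).symm) = p.app A ≫ (bundle A).zero

/-- A differential bundle over `A` in a tangent category. -/
structure DifferentialBundle (𝕋 : TangentStructure C) (A : C) where
  total : C
  proj : total ⟶ A
  powers : HasFiberPowers 𝕋.T proj
  bundle : AdditiveData proj
  isAdditiveBundle : bundle.IsAdditiveBundle
  lift : total ⟶ 𝕋.T.obj total
  lift_additive : bundle.IsAdditiveMap (bundle.map 𝕋.T powers) lift (𝕋.bundle A).zero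
  lift_additive' : bundle.IsAdditiveMap (𝕋.bundle total) lift bundle.zero
  lift_lift : lift ≫ 𝕋.T.map lift = lift ≫ 𝕋.lift.app total
  universal : bundle.IsUniversalLift 𝕋.T powers (𝕋.bundle A).zero (𝕋.bundle total).zero lift

namespace DifferentialBundle

variable {𝕋 : TangentStructure C} {A : C}

/-- A (linear) morphism of differential bundles over `A`: a map over `A` that commutes with the
lifts. -/
@[ext]
structure Hom (E E' : DifferentialBundle 𝕋 A) where
  map : E.total ⟶ E'.total
  map_proj : map ≫ E'.proj = E.proj
  map_lift : map ≫ E'.lift = E.lift ≫ 𝕋.T.map map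

instance : Category (DifferentialBundle 𝕋 A) where
  Hom := Hom
  id E := ⟨𝟙 _, by simp, by simp⟩
  comp f g := ⟨f.map ≫ g.map, by rw [Category.assoc, g.map_proj, f.map_proj], by
    rw [Category.assoc, g.map_lift, ← Category.assoc, f.map_lift, Category.assoc, 𝕋.T.map_comp]⟩
  id_comp f := Hom.ext (Category.id_comp _)
  comp_id f := Hom.ext (Category.comp_id _)
  assoc f g h := Hom.ext (Category.assoc _ _ _)

@[ext]
theorem hom_ext {E E' : DifferentialBundle 𝕋 A} {f g : E ⟶ E'} (h : Hom.map f = Hom.map g) :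
    f = g :=
  Hom.ext h

@[simp] theorem id_map (E : DifferentialBundle 𝕋 A) : Hom.map (𝟙 E) = 𝟙 E.total := rfl
@[simp] theorem comp_map {E E' E'' : DifferentialBundle 𝕋 A} (f : E ⟶ E') (g : E' ⟶ E'') :
    Hom.map (f ≫ g) = Hom.map f ≫ Hom.map g := rfl

/-- A linear morphism preserves the zero sections. -/
theorem Hom.zero_map {E E' : DifferentialBundle 𝕋 A} (f : E ⟶ E') :
    E.bundle.zero ≫ Hom.map f = E'.bundle.zero := by
  have h := congrArg (fun k => E.bundle.zero ≫ k ≫ 𝕋.p.app E'.total) (Hom.map_lift f)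
  have n : 𝕋.T.map (Hom.map f) ≫ 𝕋.p.app E'.total = 𝕋.p.app E.total ≫ Hom.map f :=
    𝕋.p.naturality _
  simp only [Category.assoc, E'.lift_additive'.proj, n] at h
  rw [← Category.assoc E.lift, E.lift_additive'.proj, ← Category.assoc (Hom.map f), Hom.map_proj,
    Category.assoc, ← Category.assoc, ← Category.assoc, E.isAdditiveBundle.zero_proj] at h
  simpa using h.symm

end DifferentialBundle

end Tangent

/-! ### Non-unital powers, divided power structures, modules -/

/-- The power `a ^ n` (`n ≥ 1`) in a non-unital ring; the value at `n = 0` is a placeholder. -/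
def nuPow {R : Type u} [NonUnitalCommRing R] (a : R) : ℕ → R
  | 0 => 0
  | 1 => a
  | n + 2 => nuPow a (n + 1) * a

/-- A divided power structure on a commutative, associative, non-unital `F`-algebra `R`: operations
`a ↦ a^[n]` on all of `R`, for all `n ≥ 1`. The value `dpow 0` carries no information: it is
normalised to be zero. -/
structure DivPowStructure (F : Type v) (R : Type u) [Field F] [NonUnitalCommRing R]
    [Module F R] where
  dpow : ℕ → R → R
  dpow_zero : ∀ a, dpow 0 a = 0
  dpow_smul : ∀ n, 0 < n → ∀ (c : F) (a : R), dpow n (c • a) = c ^ n • dpow n a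
  dpow_mul_dpow : ∀ m n, 0 < m → 0 < n → ∀ a : R,
    dpow m a * dpow n a = (m + n).choose m • dpow (m + n) a
  dpow_add : ∀ n, 0 < n → ∀ a b : R,
    dpow n (a + b) = dpow n a + (∑ l ∈ Finset.Ico 1 n, dpow l a * dpow (n - l) b) + dpow n b
  dpow_one : ∀ a, dpow 1 a = a
  dpow_mul : ∀ n, 0 < n → ∀ a b : R, dpow n (a * b) = n ! • (dpow n a * dpow n b)
  dpow_mul_left : ∀ n, 0 < n → ∀ a b : R, dpow n (a * b) = nuPow a n * dpow n b
  dpow_mul_right : ∀ n, 0 < n → ∀ a b : R, dpow n (a * b) = dpow n a * nuPow b n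
  dpow_comp : ∀ m n, 0 < m → 0 < n → ∀ a : R,
    dpow m (dpow n a) = ((m * n)! / (m ! * n ! ^ m)) • dpow (m * n) a

/-- A module over a commutative, associative, non-unital `F`-algebra `R`: an `F`-vector space `M`
with an `F`-bilinear action of `R` such that `(a * b) • m = a • (b • m)`. -/
structure AlgMod (F : Type v) (R : Type u) [Field F] [NonUnitalCommRing R] [Module F R] where
  carrier : Type u
  [addCommGroup : AddCommGroup carrier]
  [module : Module F carrier]
  act : R →ₙₐ[F] Module.End F carrier

namespace AlgMod

variable {F : Type v} {R : Type u} [Field F] [NonUnitalCommRing R] [Module F R]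

instance : CoeSort (AlgMod F R) (Type u) := ⟨AlgMod.carrier⟩

instance (M : AlgMod F R) : AddCommGroup M := M.addCommGroup

instance (M : AlgMod F R) : Module F M := M.module

/-- Homomorphisms of `R`-modules. -/
@[ext]
structure Hom (M N : AlgMod F R) where
  toLin : M →ₗ[F] N
  map_act : ∀ (a : R) (m : M), toLin (M.act a m) = N.act a (toLin m)

instance : Category (AlgMod F R) where
  Hom := Hom
  id M := ⟨LinearMap.id, fun _ _ => rfl⟩
  comp f g := ⟨g.toLin ∘ₗ f.toLin, fun a m => by simp [f.map_act, g.map_act]⟩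

@[ext]
theorem hom_ext {M N : AlgMod F R} {f g : M ⟶ N} (h : ∀ m, f.toLin m = g.toLin m) : f = g :=
  Hom.ext (LinearMap.ext h)

@[simp] theorem id_toLin (M : AlgMod F R) : Hom.toLin (𝟙 M) = LinearMap.id := rfl

@[simp] theorem comp_toLin {M N P : AlgMod F R} (f : M ⟶ N) (g : N ⟶ P) :
    Hom.toLin (f ≫ g) = g.toLin ∘ₗ f.toLin := rfl

/-- `R` as a module over itself. -/
def regular (F : Type v) (R : Type u) [Field F] [NonUnitalCommRing R] [Module F R]
    [IsScalarTower F R R] [SMulCommClass F R R] : AlgMod F R where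
  carrier := R
  act :=
    { toFun := fun a => LinearMap.mulLeft F a
      map_smul' := fun c a => LinearMap.ext fun b => smul_mul_assoc c a b
      map_zero' := by ext b; simp
      map_add' := fun a a' => by ext b; simp [add_mul]
      map_mul' := fun a a' => by ext b; simp }

theorem regular_act [IsScalarTower F R R] [SMulCommClass F R R] (a b : R) : (regular F R).act a b = (a * b : R) := rfl

end AlgMod

/-! ### The semidirect product -/

/-- The underlying set `R × M` of the semidirect product of `R` and an `R`-module `M`. -/
@[ext]
structure Semidirect {F : Type v} {R : Type u} [Field F] [NonUnitalCommRing R] [Module F R]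
    (M : AlgMod F R) where
  fst : R
  snd : M

namespace Semidirect

variable {F : Type v} {R : Type u} [Field F] [NonUnitalCommRing R] [Module F R]
  {M : AlgMod F R}

instance : Zero (Semidirect M) := ⟨⟨0, 0⟩⟩
instance : Add (Semidirect M) := ⟨fun x y => ⟨x.fst + y.fst, x.snd + y.snd⟩⟩
instance : Neg (Semidirect M) := ⟨fun x => ⟨-x.fst, -x.snd⟩⟩
instance : Sub (Semidirect M) := ⟨fun x y => ⟨x.fst - y.fst, x.snd - y.snd⟩⟩
instance instSMulNat : SMul ℕ (Semidirect M) := ⟨fun n x => ⟨n • x.fst, n • x.snd⟩⟩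
instance instSMulInt : SMul ℤ (Semidirect M) := ⟨fun n x => ⟨n • x.fst, n • x.snd⟩⟩
instance instSMulField : SMul F (Semidirect M) := ⟨fun c x => ⟨c • x.fst, c • x.snd⟩⟩
/-- `(a, m) * (b, n) = (a * b, a • n + b • m)`. -/
instance : Mul (Semidirect M) :=
  ⟨fun x y => ⟨x.fst * y.fst, M.act x.fst y.snd + M.act y.fst x.snd⟩⟩

@[simp] theorem zero_fst : (0 : Semidirect M).fst = 0 := rfl
@[simp] theorem zero_snd : (0 : Semidirect M).snd = 0 := rfl
@[simp] theorem add_fst (x y : Semidirect M) : (x + y).fst = x.fst + y.fst := rfl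
@[simp] theorem add_snd (x y : Semidirect M) : (x + y).snd = x.snd + y.snd := rfl
@[simp] theorem neg_fst (x : Semidirect M) : (-x).fst = -x.fst := rfl
@[simp] theorem neg_snd (x : Semidirect M) : (-x).snd = -x.snd := rfl
@[simp] theorem nsmul_fst (n : ℕ) (x : Semidirect M) : (n • x).fst = n • x.fst := rfl
@[simp] theorem nsmul_snd (n : ℕ) (x : Semidirect M) : (n • x).snd = n • x.snd := rfl
@[simp] theorem smul_fst (c : F) (x : Semidirect M) : (c • x).fst = c • x.fst := rfl
@[simp] theorem smul_snd (c : F) (x : Semidirect M) : (c • x).snd = c • x.snd := rfl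
@[simp] theorem mul_fst (x y : Semidirect M) : (x * y).fst = x.fst * y.fst := rfl
@[simp] theorem mul_snd (x y : Semidirect M) :
    (x * y).snd = M.act x.fst y.snd + M.act y.fst x.snd := rfl

/-- The underlying pair. -/
def toProd (x : Semidirect M) : R × M := (x.fst, x.snd)

theorem toProd_injective : Function.Injective (toProd (M := M)) := fun x y h => by
  ext
  · exact congrArg Prod.fst h
  · exact congrArg Prod.snd h

instance : AddCommGroup (Semidirect M) :=
  toProd_injective.addCommGroup toProd rfl (fun _ _ => rfl) (fun _ => rfl) (fun _ _ => rfl)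
    (fun _ _ => rfl) (fun _ _ => rfl)

instance : Module F (Semidirect M) :=
  toProd_injective.module F ⟨⟨toProd, rfl⟩, fun _ _ => rfl⟩ (fun _ _ => rfl)

instance : NonUnitalCommRing (Semidirect M) :=
  { (inferInstance : AddCommGroup (Semidirect M)) with
    left_distrib := fun x y z => by
      ext
      · simp [mul_add]
      · simp; abel
    right_distrib := fun x y z => by
      ext
      · simp [add_mul]
      · simp; abel
    zero_mul := fun x => by ext <;> simp
    mul_zero := fun x => by ext <;> simp
    mul_assoc := fun x y z => by
      ext
      · simp [mul_assoc]
      · simp only [mul_snd, mul_fst, map_mul, map_add, Module.End.mul_apply]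
        rw [← Module.End.mul_apply, ← Module.End.mul_apply, ← map_mul, ← map_mul, mul_comm x.fst,
          mul_comm z.fst, map_mul, map_mul]
        simp only [Module.End.mul_apply]
        rw [← Module.End.mul_apply (M.act z.fst), ← map_mul, mul_comm z.fst, map_mul]
        simp only [Module.End.mul_apply]
        abel
    mul_comm := fun x y => by
      ext
      · simp [mul_comm]
      · simp [add_comm] }

@[simp] theorem sum_fst {ι : Type*} (s : Finset ι) (f : ι → Semidirect M) :
    (∑ i ∈ s, f i).fst = ∑ i ∈ s, (f i).fst :=
  map_sum (⟨⟨Semidirect.fst, rfl⟩, fun _ _ => rfl⟩ : Semidirect M →+ R) f s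

@[simp] theorem sum_snd {ι : Type*} (s : Finset ι) (f : ι → Semidirect M) :
    (∑ i ∈ s, f i).snd = ∑ i ∈ s, (f i).snd :=
  map_sum (⟨⟨Semidirect.snd, rfl⟩, fun _ _ => rfl⟩ : Semidirect M →+ M) f s

instance [IsScalarTower F R R] : IsScalarTower F (Semidirect M) (Semidirect M) :=
  ⟨fun c x y => by ext <;> simp [smul_mul_assoc]⟩

instance [IsScalarTower F R R] : SMulCommClass F (Semidirect M) (Semidirect M) :=
  ⟨fun c x y => by
    rw [smul_eq_mul, smul_eq_mul, mul_comm x, mul_comm x, ← smul_eq_mul, ← smul_eq_mul,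
      smul_assoc]⟩

end Semidirect

theorem nuPow_eq {R : Type u} [NonUnitalCommRing R] (d : ℕ → R → R) (h1 : ∀ a, d 1 a = a)
    (h : ∀ m n, 0 < m → 0 < n → ∀ a : R, d m a * d n a = (m + n).choose m • d (m + n) a)
    (a : R) (n : ℕ) (hn : 0 < n) : nuPow a n = n ! • d n a := by
  induction n, hn using Nat.le_induction with
  | base => simp [nuPow, h1]
  | succ n hn ih =>
    obtain ⟨k, rfl⟩ : ∃ k, n = k + 1 := ⟨n - 1, by omega⟩
    have h2 := h (k + 1) 1 (by omega) one_pos a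
    rw [h1] at h2
    rw [show nuPow a (k + 1 + 1) = nuPow a (k + 1) * a from rfl, ih, smul_mul_assoc, h2, smul_smul,
      Nat.choose_succ_self_right, mul_comm, ← Nat.factorial_succ]

/-! ### The semidirect product with trivial `p`-map as a divided power algebra -/

namespace DivPowStructure

variable {F : Type v} {R : Type u} [Field F] [NonUnitalCommRing R] [Module F R]

theorem dpow_comp' (D : DivPowStructure F R) (m n : ℕ) (hm : 0 < m) (hn : 0 < n) (a : R) :
    D.dpow m (D.dpow n a) = Nat.uniformBell m n • D.dpow (m * n) a := by
  rw [D.dpow_comp m n hm hn, Nat.uniformBell_eq_div m hn.ne', mul_comm (m !)]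

/-- The action of `a^[n]` on a module `M`, where `a^[0]` acts as the identity. -/
def dpAct (D : DivPowStructure F R) (M : AlgMod F R) : ℕ → R → Module.End F M
  | 0, _ => 1
  | n + 1, a => M.act (D.dpow (n + 1) a)

variable (D : DivPowStructure F R) (M : AlgMod F R)

theorem act_dpow (n : ℕ) (hn : 0 < n) (a : R) : M.act (D.dpow n a) = D.dpAct M n a := by
  obtain ⟨k, rfl⟩ : ∃ k, n = k + 1 := ⟨n - 1, by omega⟩
  rfl

theorem dpAct_one (a : R) : D.dpAct M 1 a = M.act a := by
  rw [← D.act_dpow M 1 one_pos, D.dpow_one]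

theorem dpAct_mul (m n : ℕ) (a : R) :
    D.dpAct M m a * D.dpAct M n a = (m + n).choose m • D.dpAct M (m + n) a := by
  rcases Nat.eq_zero_or_pos m with rfl | hm
  · simp [dpAct]
  rcases Nat.eq_zero_or_pos n with rfl | hn
  · simp [dpAct]
  rw [← act_dpow _ _ _ hm, ← act_dpow _ _ _ hn, ← act_dpow _ _ _ (by omega), ← map_mul,
    D.dpow_mul_dpow m n hm hn, map_nsmul]

theorem dpAct_smul (n : ℕ) (c : F) (a : R) : D.dpAct M n (c • a) = c ^ n • D.dpAct M n a := by
  rcases Nat.eq_zero_or_pos n with rfl | hn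
  · simp [dpAct]
  rw [← act_dpow _ _ _ hn, ← act_dpow _ _ _ hn, D.dpow_smul n hn, map_smul]

theorem dpAct_comm (m n : ℕ) (a b : R) :
    D.dpAct M m a * D.dpAct M n b = D.dpAct M n b * D.dpAct M m a := by
  rcases Nat.eq_zero_or_pos m with rfl | hm
  · simp [dpAct]
  rcases Nat.eq_zero_or_pos n with rfl | hn
  · simp [dpAct]
  rw [← act_dpow _ _ _ hm, ← act_dpow _ _ _ hn, ← map_mul, ← map_mul, mul_comm]

theorem dpAct_add (n : ℕ) (a b : R) : D.dpAct M n (a + b) =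
    ∑ l ∈ Finset.range (n + 1), D.dpAct M l a * D.dpAct M (n - l) b := by
  rcases Nat.eq_zero_or_pos n with rfl | hn
  · simp [dpAct]
  rw [← act_dpow _ _ _ hn, D.dpow_add n hn, map_add, map_add, map_sum, Finset.sum_range_succ,
    Finset.range_eq_Ico, Finset.sum_eq_sum_Ico_succ_bot hn, act_dpow _ _ _ hn, act_dpow _ _ _ hn]
  have : ∀ l ∈ Finset.Ico 1 n, M.act (D.dpow l a * D.dpow (n - l) b)
      = D.dpAct M l a * D.dpAct M (n - l) b := fun l hl => by
    rw [Finset.mem_Ico] at hl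
    rw [map_mul, act_dpow _ _ _ (by omega), act_dpow _ _ _ (by omega)]
  rw [Finset.sum_congr rfl this]
  simp only [dpAct, Nat.sub_zero, one_mul, Nat.sub_self, mul_one, zero_add]
  abel

theorem dpAct_prod (n : ℕ) (a b : R) :
    D.dpAct M n (a * b) = n ! • (D.dpAct M n a * D.dpAct M n b) := by
  rcases Nat.eq_zero_or_pos n with rfl | hn
  · simp [dpAct]
  rw [← act_dpow _ _ _ hn, ← act_dpow _ _ _ hn, ← act_dpow _ _ _ hn, D.dpow_mul n hn, map_nsmul,
    map_mul]

theorem dpAct_comp (m n : ℕ) (hn : 0 < n) (a : R) :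
    D.dpAct M m (D.dpow n a) = Nat.uniformBell m n • D.dpAct M (m * n) a := by
  rcases Nat.eq_zero_or_pos m with rfl | hm
  · simp [dpAct, Nat.uniformBell_zero_left]
  rw [← act_dpow _ _ _ hm, ← act_dpow _ _ _ (Nat.mul_pos hm hn), D.dpow_comp' m n hm hn,
    map_nsmul]

/-- The divided power operations of the semidirect product with trivial `p`-map:
`(a, m)^[1] = (a, m)` and `(a, m)^[n] = (a^[n], a^[n-1] • m)` for `n ≥ 2`. In characteristic `p`
one has `a^[p-1] = -a^(p-1)`, see `semidirect_dpow_p` below. -/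
def semidirectDpow : ℕ → Semidirect M → Semidirect M
  | 0, _ => 0
  | 1, x => x
  | n + 2, x => ⟨D.dpow (n + 2) x.fst, M.act (D.dpow (n + 1) x.fst) x.snd⟩

theorem semidirectDpow_succ (n : ℕ) (x : Semidirect M) :
    D.semidirectDpow M (n + 1) x = ⟨D.dpow (n + 1) x.fst, D.dpAct M n x.fst x.snd⟩ := by
  cases n with
  | zero => simp [semidirectDpow, dpAct, D.dpow_one]
  | succ n => rfl

theorem semidirectDpow_of_pos (n : ℕ) (hn : 0 < n) (x : Semidirect M) :
    D.semidirectDpow M n x = ⟨D.dpow n x.fst, D.dpAct M (n - 1) x.fst x.snd⟩ := by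
  obtain ⟨k, rfl⟩ : ∃ k, n = k + 1 := ⟨n - 1, by omega⟩
  exact D.semidirectDpow_succ M k x

theorem semidirectDpow_mul_dpow (m n : ℕ) (hm : 0 < m) (hn : 0 < n) (x : Semidirect M) :
    D.semidirectDpow M m x * D.semidirectDpow M n x
      = (m + n).choose m • D.semidirectDpow M (m + n) x := by
  rw [semidirectDpow_of_pos _ _ _ hm, semidirectDpow_of_pos _ _ _ hn,
    semidirectDpow_of_pos _ _ _ (by omega)]
  ext
  · simp [D.dpow_mul_dpow m n hm hn]
  · obtain ⟨k, rfl⟩ : ∃ k, m = k + 1 := ⟨m - 1, by omega⟩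
    obtain ⟨l, rfl⟩ : ∃ l, n = l + 1 := ⟨n - 1, by omega⟩
    simp only [Semidirect.mul_snd, Semidirect.nsmul_snd, act_dpow _ _ _ (Nat.succ_pos _),
      Nat.add_sub_cancel, ← Module.End.mul_apply, dpAct_mul]
    rw [show k + 1 + (l + 1) - 1 = k + l + 1 by omega, show l + 1 + k = k + l + 1 by omega,
      show k + 1 + l = k + l + 1 by omega, ← LinearMap.add_apply, ← add_smul,
      show k + 1 + (l + 1) = k + l + 1 + 1 by omega, Nat.choose_succ_succ (k + l + 1) k,
      ← Nat.choose_symm_of_eq_add (show k + l + 1 = k + (l + 1) by omega), add_comm]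
    rfl

theorem semidirectDpow_mul (n : ℕ) (hn : 0 < n) (x y : Semidirect M) :
    D.semidirectDpow M n (x * y)
      = n ! • (D.semidirectDpow M n x * D.semidirectDpow M n y) := by
  obtain ⟨k, rfl⟩ : ∃ k, n = k + 1 := ⟨n - 1, by omega⟩
  simp only [semidirectDpow_succ]
  ext
  · simp [D.dpow_mul (k + 1) hn]
  · have key : ∀ a b : R, D.dpAct M k (a * b) * M.act a
        = (k + 1)! • (D.dpAct M (k + 1) a * D.dpAct M k b) := fun a b => by
      rw [dpAct_prod, ← dpAct_one D, dpAct_comm D M k k, smul_mul_assoc, mul_assoc, dpAct_mul,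
        Nat.choose_succ_self_right, mul_smul_comm, smul_smul, dpAct_comm D M k (k + 1),
        Nat.factorial_succ, mul_comm (k !)]
    simp only [Semidirect.mul_snd, Semidirect.mul_fst, Semidirect.nsmul_snd,
      act_dpow _ _ _ (Nat.succ_pos _), map_add, ← Module.End.mul_apply]
    rw [key, mul_comm x.fst, key, smul_add]
    rfl

theorem semidirectDpow_add (n : ℕ) (hn : 0 < n) (x y : Semidirect M) :
    D.semidirectDpow M n (x + y) = D.semidirectDpow M n x
      + (∑ l ∈ Finset.Ico 1 n, D.semidirectDpow M l x * D.semidirectDpow M (n - l) y)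
      + D.semidirectDpow M n y := by
  have hs : ∑ l ∈ Finset.Ico 1 n, D.semidirectDpow M l x * D.semidirectDpow M (n - l) y
      = ∑ l ∈ Finset.Ico 1 n, ((⟨D.dpow l x.fst, D.dpAct M (l - 1) x.fst x.snd⟩ : Semidirect M) *
        ⟨D.dpow (n - l) y.fst, D.dpAct M (n - l - 1) y.fst y.snd⟩) :=
    Finset.sum_congr rfl fun l hl => by
      rw [Finset.mem_Ico] at hl
      rw [semidirectDpow_of_pos _ _ _ (by omega), semidirectDpow_of_pos _ _ _ (by omega)]
  rw [hs, semidirectDpow_of_pos _ _ _ hn, semidirectDpow_of_pos _ _ _ hn,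
    semidirectDpow_of_pos _ _ _ hn]
  ext
  · simp [D.dpow_add n hn]
  · obtain ⟨k, rfl⟩ : ∃ k, n = k + 1 := ⟨n - 1, by omega⟩
    have e1 : ∑ l ∈ Finset.Ico 1 (k + 1), M.act (D.dpow l x.fst)
          (D.dpAct M (k + 1 - l - 1) y.fst y.snd)
        = ∑ l ∈ Finset.Ico 1 (k + 1), (D.dpAct M l x.fst * D.dpAct M (k - l) y.fst) y.snd :=
      Finset.sum_congr rfl fun l hl => by
        rw [Finset.mem_Ico] at hl
        rw [act_dpow _ _ _ (by omega), show k + 1 - l - 1 = k - l by omega, Module.End.mul_apply]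
    have e2 : ∑ l ∈ Finset.Ico 1 (k + 1), M.act (D.dpow (k + 1 - l) y.fst)
          (D.dpAct M (l - 1) x.fst x.snd)
        = ∑ l ∈ Finset.range k, (D.dpAct M l x.fst * D.dpAct M (k - l) y.fst) x.snd := by
      rw [Finset.sum_Ico_eq_sum_range]
      refine Finset.sum_congr (by simp) fun l hl => ?_
      simp only [Finset.mem_range] at hl
      rw [act_dpow _ _ _ (by omega), show k + 1 - (1 + l) = k - l by omega,
        show 1 + l - 1 = l by omega, dpAct_comm, Module.End.mul_apply]
    simp only [Semidirect.add_snd, Semidirect.sum_snd, Semidirect.mul_snd, Semidirect.add_fst,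
      Nat.add_sub_cancel, map_add, Finset.sum_add_distrib, e1, e2, dpAct_add,
      LinearMap.sum_apply]
    rw [Finset.sum_range_succ (n := k)]
    nth_rewrite 2 [Finset.range_eq_Ico]
    rw [Finset.sum_eq_sum_Ico_succ_bot (by omega : 0 < k + 1)]
    simp only [Nat.sub_zero, Nat.sub_self, dpAct, mul_one, one_mul, zero_add]
    abel

theorem semidirectDpow_comp (m n : ℕ) (hm : 0 < m) (hn : 0 < n) (x : Semidirect M) :
    D.semidirectDpow M m (D.semidirectDpow M n x)
      = ((m * n)! / (m ! * n ! ^ m)) • D.semidirectDpow M (m * n) x := by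
  rw [semidirectDpow_of_pos _ _ _ hm, semidirectDpow_of_pos _ _ _ hn,
    semidirectDpow_of_pos _ _ _ (Nat.mul_pos hm hn)]
  ext
  · simp [D.dpow_comp m n hm hn]
  · obtain ⟨k, rfl⟩ : ∃ k, m = k + 1 := ⟨m - 1, by omega⟩
    simp only [Nat.add_sub_cancel, Semidirect.nsmul_snd]
    rw [← Module.End.mul_apply, dpAct_comp _ _ _ _ hn, smul_mul_assoc, dpAct_mul, smul_smul,
      mul_comm ((k + 1)!), ← Nat.uniformBell_eq_div _ hn.ne', Nat.uniformBell_succ_left,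
      show k * n + (n - 1) = k * n + n - 1 by omega, show (k + 1) * n - 1 = k * n + n - 1 by
        rw [Nat.succ_mul], mul_comm (Nat.uniformBell k n),
      Nat.choose_symm_of_eq_add (show k * n + n - 1 = k * n + (n - 1) by omega)]
    rfl

/-- The divided power structure of the semidirect product `R ⋉_p M`, for a module `M` with trivial
`p`-map. -/
abbrev semidirect : DivPowStructure F (Semidirect M) where
  dpow := D.semidirectDpow M
  dpow_zero _ := rfl
  dpow_smul n hn c x := by
    obtain ⟨k, rfl⟩ : ∃ k, n = k + 1 := ⟨n - 1, by omega⟩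
    simp only [semidirectDpow_succ]
    ext
    · simp [D.dpow_smul (k + 1) hn]
    · simp [dpAct_smul, smul_smul, pow_succ, mul_comm]
  dpow_mul_dpow := D.semidirectDpow_mul_dpow M
  dpow_add := D.semidirectDpow_add M
  dpow_one _ := rfl
  dpow_mul := D.semidirectDpow_mul M
  dpow_mul_left n hn x y := by
    rw [D.semidirectDpow_mul M n hn, nuPow_eq _ (fun _ => rfl) (D.semidirectDpow_mul_dpow M) x n hn,
      smul_mul_assoc]
  dpow_mul_right n hn x y := by
    rw [D.semidirectDpow_mul M n hn, nuPow_eq _ (fun _ => rfl) (D.semidirectDpow_mul_dpow M) y n hn,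
      mul_smul_comm]
  dpow_comp := D.semidirectDpow_comp M

theorem semidirect_dpow_succ (n : ℕ) (x : Semidirect M) :
    (D.semidirect M).dpow (n + 1) x = ⟨D.dpow (n + 1) x.fst, D.dpAct M n x.fst x.snd⟩ :=
  D.semidirectDpow_succ M n x

/-- In characteristic `p` the `p`-th divided power of the semidirect product is
`(a, m)^[p] = (a^[p], - a^(p-1) • m)`. -/
theorem semidirect_dpow_p (p : ℕ) [Fact p.Prime] [CharP F p] (x : Semidirect M) :
    (D.semidirect M).dpow p x =
      ⟨D.dpow p x.fst, -(M.act (nuPow x.fst (p - 1)) x.snd)⟩ := by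
  have hp : p.Prime := Fact.out
  have h2 := hp.two_le
  have hw : (((p - 1)! : ℕ) : F) = -1 := by
    have h := congrArg (ZMod.castHom (dvd_refl p) F) (ZMod.wilsons_lemma p)
    rw [map_natCast, map_neg, map_one] at h
    exact h
  obtain ⟨k, rfl⟩ : ∃ k, p = k + 1 := ⟨p - 1, by omega⟩
  rw [semidirect_dpow_succ, nuPow_eq D.dpow D.dpow_one D.dpow_mul_dpow _ _ (by omega), map_nsmul,
    D.act_dpow M _ (by omega), Nat.add_sub_cancel, ← Nat.cast_smul_eq_nsmul F]
  rw [Nat.add_sub_cancel] at hw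
  rw [hw]
  simp

end DivPowStructure

/-! ### The category of divided power algebras -/

/-- A divided power algebra over the field `F`. -/
structure DivPowAlg (F : Type v) [Field F] where
  carrier : Type u
  [ring : NonUnitalCommRing carrier]
  [module : Module F carrier]
  [isScalarTower : IsScalarTower F carrier carrier]
  [smulCommClass : SMulCommClass F carrier carrier]
  dp : DivPowStructure F carrier

namespace DivPowAlg

variable {F : Type v} [Field F]

instance : CoeSort (DivPowAlg.{v, u} F) (Type u) := ⟨DivPowAlg.carrier⟩

instance (A : DivPowAlg.{v, u} F) : NonUnitalCommRing A := A.ring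
instance (A : DivPowAlg.{v, u} F) : Module F A := A.module
instance (A : DivPowAlg.{v, u} F) : IsScalarTower F A A := A.isScalarTower
instance (A : DivPowAlg.{v, u} F) : SMulCommClass F A A := A.smulCommClass

/-- Morphisms of divided power algebras. -/
@[ext]
structure Hom (A B : DivPowAlg.{v, u} F) where
  toAlgHom : A →ₙₐ[F] B
  map_dpow : ∀ n a, toAlgHom (A.dp.dpow n a) = B.dp.dpow n (toAlgHom a)

instance : Category (DivPowAlg.{v, u} F) where
  Hom := Hom
  id A := ⟨NonUnitalAlgHom.id F A, fun _ _ => rfl⟩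
  comp f g := ⟨g.toAlgHom.comp f.toAlgHom, fun n a => by simp [f.map_dpow, g.map_dpow]⟩

/-- The map of underlying sets. -/
def Hom.fn {A B : DivPowAlg.{v, u} F} (f : A ⟶ B) : A → B := fun a => Hom.toAlgHom f a

theorem hom_ext {A B : DivPowAlg.{v, u} F} {f g : A ⟶ B} (h : ∀ a, Hom.fn f a = Hom.fn g a) :
    f = g :=
  Hom.ext (NonUnitalAlgHom.ext h)

@[simp] theorem fn_id (A : DivPowAlg.{v, u} F) (a : A) : Hom.fn (𝟙 A) a = a := rfl
@[simp] theorem fn_comp {A B C : DivPowAlg.{v, u} F} (f : A ⟶ B) (g : B ⟶ C) (a : A) :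
    Hom.fn (f ≫ g) a = Hom.fn g (Hom.fn f a) := rfl

section
variable {A B : DivPowAlg.{v, u} F} (f : A ⟶ B)
theorem fn_add (a b : A) : Hom.fn f (a + b) = Hom.fn f a + Hom.fn f b := map_add f.toAlgHom a b
theorem fn_mul (a b : A) : Hom.fn f (a * b) = Hom.fn f a * Hom.fn f b := map_mul f.toAlgHom a b
theorem fn_smul (c : F) (a : A) : Hom.fn f (c • a) = c • Hom.fn f a := map_smul f.toAlgHom c a
theorem fn_zero : Hom.fn f 0 = 0 := map_zero f.toAlgHom
theorem fn_neg (a : A) : Hom.fn f (-a) = -Hom.fn f a := map_neg f.toAlgHom a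
theorem fn_sub (a b : A) : Hom.fn f (a - b) = Hom.fn f a - Hom.fn f b := map_sub f.toAlgHom a b
theorem fn_dpow (n : ℕ) (a : A) : Hom.fn f (A.dp.dpow n a) = B.dp.dpow n (Hom.fn f a) :=
  Hom.map_dpow f n a
end

/-- Build a morphism from a function compatible with all operations. -/
def mkHom {A B : DivPowAlg.{v, u} F} (f : A → B) (hsmul : ∀ (c : F) a, f (c • a) = c • f a)
    (hadd : ∀ a b, f (a + b) = f a + f b) (hmul : ∀ a b, f (a * b) = f a * f b)
    (hdpow : ∀ n a, f (A.dp.dpow (n + 1) a) = B.dp.dpow (n + 1) (f a)) : A ⟶ B :=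
  have h0 : f 0 = 0 := by simpa using hsmul 0 0
  { toAlgHom :=
      { toFun := f, map_smul' := hsmul, map_zero' := h0, map_add' := hadd, map_mul' := hmul }
    map_dpow := fun n a => by
      cases n with
      | zero =>
        rw [A.dp.dpow_zero, B.dp.dpow_zero]
        exact h0
      | succ n => exact hdpow n a }

@[simp] theorem fn_mkHom {A B : DivPowAlg.{v, u} F} (f : A → B) (h1 h2 h3 h4) (a : A) :
    Hom.fn (mkHom (A := A) (B := B) f h1 h2 h3 h4) a = f a := rfl

/-- The category of modules over the underlying commutative algebra `U(A)` of `A`. -/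
abbrev UMod (A : DivPowAlg.{v, u} F) : Type (max v (u + 1)) := AlgMod.{v, u} F A

/-- The divided power algebra `A ⋉_p M`, for a `U(A)`-module `M` with trivial `p`-map. -/
abbrev semidirect (A : DivPowAlg.{v, u} F) (M : A.UMod) : DivPowAlg.{v, u} F where
  carrier := Semidirect M
  dp := A.dp.semidirect M

/-! ### Limits of divided power algebras -/

section Limits

variable {J : Type} [SmallCategory J]

/-- A cone whose underlying set is the set of compatible families. -/
def IsElementwiseLimit {K : J ⥤ DivPowAlg.{v, u} F} (c : Cone K) : Prop :=
  ∀ s : (∀ j, K.obj j), (∀ ⦃i j : J⦄ (f : i ⟶ j), Hom.fn (K.map f) (s i) = s j) →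
    ∃! x : c.pt, ∀ j, Hom.fn (c.π.app j) x = s j

theorem IsElementwiseLimit.ext {K : J ⥤ DivPowAlg.{v, u} F} {c : Cone K}
    (h : IsElementwiseLimit c) {x y : c.pt}
    (hxy : ∀ j, Hom.fn (c.π.app j) x = Hom.fn (c.π.app j) y) : x = y :=
  (h (fun j => Hom.fn (c.π.app j) y) fun i j f => by
    rw [← fn_comp, c.w]).unique hxy fun _ => rfl

theorem IsElementwiseLimit.nonempty_isLimit {K : J ⥤ DivPowAlg.{v, u} F} {c : Cone K}
    (h : IsElementwiseLimit c) : Nonempty (IsLimit c) := by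
  have hs : ∀ (s : Cone K) (a : s.pt), ∃ x : c.pt, ∀ j,
      Hom.fn (c.π.app j) x = Hom.fn (s.π.app j) a := fun s a =>
    (h (fun j => Hom.fn (s.π.app j) a) fun i j f => by rw [← fn_comp, s.w]).exists
  choose l hl using hs
  exact ⟨{
    lift := fun s => mkHom (l s)
      (fun r a => h.ext fun j => by simp only [hl, fn_smul])
      (fun a b => h.ext fun j => by simp only [hl, fn_add])
      (fun a b => h.ext fun j => by simp only [hl, fn_mul])
      (fun n a => h.ext fun j =>
        (hl s _ j).trans ((fn_dpow (A := s.pt) (s.π.app j) (n + 1) a).trans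
          ((congrArg ((K.obj j).dp.dpow (n + 1)) (hl s a j).symm).trans
            (fn_dpow (A := c.pt) (c.π.app j) (n + 1) (l s a)).symm)))
    fac := fun s j => hom_ext fun a => hl s a j
    uniq := fun s m hm => hom_ext fun a => h.ext fun j => by
      rw [fn_mkHom, hl, ← fn_comp, hm] }⟩

/-- The set of compatible families of a diagram. -/
def Sections (K : J ⥤ DivPowAlg.{v, u} F) : Type u :=
  { s : (∀ j, K.obj j) // ∀ ⦃i j : J⦄ (f : i ⟶ j), Hom.fn (K.map f) (s i) = s j }

namespace Sections

variable (K : J ⥤ DivPowAlg.{v, u} F)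

/-- The compatible families as a subspace of the product. -/
def submodule : Submodule F (∀ j, K.obj j) where
  carrier := { s | ∀ ⦃i j : J⦄ (f : i ⟶ j), Hom.fn (K.map f) (s i) = s j }
  add_mem' ha hb i j f := by simp [fn_add, ha f, hb f]
  zero_mem' i j f := by simp [fn_zero]
  smul_mem' c a ha i j f := by simp [fn_smul, ha f]

instance : AddCommGroup (Sections K) := inferInstanceAs (AddCommGroup (submodule K))
instance : Module F (Sections K) := inferInstanceAs (Module F (submodule K))
instance : Mul (Sections K) := ⟨fun s t => ⟨fun j => s.1 j * t.1 j, fun i j f => by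
  rw [fn_mul, s.2 f, t.2 f]⟩⟩

variable {K}

@[ext] theorem ext {s t : Sections K} (h : ∀ j, s.1 j = t.1 j) : s = t := Subtype.ext (funext h)

@[simp] theorem add_val (s t : Sections K) (j : J) : (s + t).1 j = s.1 j + t.1 j := rfl
@[simp] theorem zero_val (j : J) : (0 : Sections K).1 j = 0 := rfl
@[simp] theorem smul_val (c : F) (s : Sections K) (j : J) : (c • s).1 j = c • s.1 j := rfl
@[simp] theorem nsmul_val (n : ℕ) (s : Sections K) (j : J) : (n • s).1 j = n • s.1 j := rfl
@[simp] theorem mul_val (s t : Sections K) (j : J) : (s * t).1 j = s.1 j * t.1 j := rfl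

instance : NonUnitalCommRing (Sections K) :=
  { (inferInstance : AddCommGroup (Sections K)) with
    left_distrib := fun x y z => by ext j; simp [mul_add]
    right_distrib := fun x y z => by ext j; simp [add_mul]
    zero_mul := fun x => by ext j; simp
    mul_zero := fun x => by ext j; simp
    mul_assoc := fun x y z => by ext j; simp [mul_assoc]
    mul_comm := fun x y => by ext j; simp [mul_comm] }

instance : IsScalarTower F (Sections K) (Sections K) :=
  ⟨fun c x y => by ext j; simp [smul_mul_assoc]⟩
instance : SMulCommClass F (Sections K) (Sections K) :=
  ⟨fun c x y => by ext j; simp [mul_smul_comm]⟩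

@[simp] theorem sum_val {ι : Type*} (s : Finset ι) (f : ι → Sections K) (j : J) :
    (∑ i ∈ s, f i).1 j = ∑ i ∈ s, (f i).1 j :=
  map_sum (⟨⟨fun t => t.1 j, rfl⟩, fun _ _ => rfl⟩ : Sections K →+ K.obj j) f s

theorem nuPow_val (s : Sections K) (n : ℕ) (j : J) : (nuPow s n).1 j = nuPow (s.1 j) n := by
  induction n using Nat.strong_induction_on with
  | _ n ih =>
    match n, ih with
    | 0, _ => rfl
    | 1, _ => rfl
    | k + 2, ih => simp [nuPow, ih (k + 1) (by omega)]

/-- Componentwise divided powers. -/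
def dpow (n : ℕ) (s : Sections K) : Sections K :=
  ⟨fun j => (K.obj j).dp.dpow n (s.1 j), fun i j f => by rw [fn_dpow, s.2 f]⟩

@[simp] theorem dpow_val (n : ℕ) (s : Sections K) (j : J) :
    (dpow n s).1 j = (K.obj j).dp.dpow n (s.1 j) := rfl

/-- Compatible families form a divided power algebra. -/
def alg (K : J ⥤ DivPowAlg.{v, u} F) : DivPowAlg.{v, u} F where
  carrier := Sections K
  dp :=
    { dpow := dpow
      dpow_zero := fun s => by ext j; exact (K.obj j).dp.dpow_zero _
      dpow_smul := fun n hn c s => by ext j; exact (K.obj j).dp.dpow_smul n hn c _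
      dpow_mul_dpow := fun m n hm hn s => by
        ext j; exact (K.obj j).dp.dpow_mul_dpow m n hm hn _
      dpow_add := fun n hn s t => by
        ext j
        simp [(K.obj j).dp.dpow_add n hn]
      dpow_one := fun s => by ext j; exact (K.obj j).dp.dpow_one _
      dpow_mul := fun n hn s t => by ext j; exact (K.obj j).dp.dpow_mul n hn _ _
      dpow_mul_left := fun n hn s t => by
        ext j; simp [(K.obj j).dp.dpow_mul_left n hn, nuPow_val]
      dpow_mul_right := fun n hn s t => by
        ext j; simp [(K.obj j).dp.dpow_mul_right n hn, nuPow_val]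
      dpow_comp := fun m n hm hn s => by ext j; exact (K.obj j).dp.dpow_comp m n hm hn _ }

/-- The cone of compatible families. -/
def cone (K : J ⥤ DivPowAlg.{v, u} F) : Cone K where
  pt := alg K
  π :=
    { app := fun j => mkHom (A := alg K) (fun s => s.1 j) (fun _ _ => rfl) (fun _ _ => rfl)
        (fun _ _ => rfl) (fun _ _ => rfl)
      naturality := fun _ _ f => hom_ext fun s => (s.2 f).symm }

theorem cone_isElementwiseLimit (K : J ⥤ DivPowAlg.{v, u} F) : IsElementwiseLimit (cone K) :=
  fun s hs => ⟨⟨s, hs⟩, fun _ => rfl, fun _ ht => ext ht⟩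

end Sections

instance (J : Type) [SmallCategory J] : HasLimitsOfShape J (DivPowAlg.{v, u} F) where
  has_limit K := ⟨⟨⟨Sections.cone K,
    (Sections.cone_isElementwiseLimit K).nonempty_isLimit.some⟩⟩⟩

end Limits

end DivPowAlg

namespace AlgMod

variable {F : Type v} {R : Type u} [Field F] [NonUnitalCommRing R] [Module F R]

/-- The product `M × M` with the componentwise action. -/
def square (M : AlgMod F R) : AlgMod F R where
  carrier := M × M
  act :=
    { toFun := fun a => (M.act a).prodMap (M.act a)
      map_smul' := fun c a => by ext x <;> simp
      map_zero' := by ext x <;> simp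
      map_add' := fun a b => by ext x <;> simp
      map_mul' := fun a b => by ext x <;> simp }

@[simp] theorem square_act (M : AlgMod F R) (a : R) (m m' : M) :
    M.square.act a (m, m') = (M.act a m, M.act a m') := rfl

end AlgMod

namespace DivPowAlg

variable {F : Type v} [Field F]

theorem dpow_semidirect (A : DivPowAlg.{v, u} F) (M : A.UMod) (n : ℕ) (x : Semidirect M) :
    (A.semidirect M).dp.dpow (n + 1) x = (⟨A.dp.dpow (n + 1) x.fst, A.dp.dpAct M n x.fst x.snd⟩ :
      Semidirect M) :=
  A.dp.semidirect_dpow_succ M n x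

/-- Compatibility with the action of divided powers follows from that with the action. -/
theorem dpAct_compat {A B : DivPowAlg.{v, u} F} (M : A.UMod) (N : B.UMod) (f : A → B) (g : M → N)
    (hf : ∀ n a, f (A.dp.dpow n a) = B.dp.dpow n (f a))
    (hg : ∀ (a : A) (m : M), g (M.act a m) = N.act (f a) (g m)) (n : ℕ) (a : A) (m : M) :
    g (A.dp.dpAct M n a m) = B.dp.dpAct N n (f a) (g m) := by
  cases n with
  | zero => rfl
  | succ n => exact (hg _ _).trans (by rw [hf]; rfl)

/-- The morphism `(a, m) ↦ (f a, g m)` of semidirect products. -/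
def semidirectMap {A B : DivPowAlg.{v, u} F} (M : A.UMod) (N : B.UMod) (f : A ⟶ B) (g : M →ₗ[F] N)
    (hg : ∀ (a : A) (m : M), g (M.act a m) = N.act (Hom.fn f a) (g m)) :
    A.semidirect M ⟶ B.semidirect N :=
  mkHom (A := A.semidirect M) (B := B.semidirect N)
    (fun x : Semidirect M => (⟨Hom.fn f x.fst, g x.snd⟩ : Semidirect N))
    (fun c (x : Semidirect M) => Semidirect.ext (fn_smul f c x.fst) (map_smul g c x.snd))
    (fun (x y : Semidirect M) => Semidirect.ext (fn_add f x.fst y.fst) (map_add g x.snd y.snd))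
    (fun (x y : Semidirect M) => Semidirect.ext (fn_mul f x.fst y.fst)
      ((map_add g _ _).trans (congrArg₂ (· + ·) (hg _ _) (hg _ _))))
    (fun n (x : Semidirect M) => by
      rw [dpow_semidirect, dpow_semidirect]
      exact Semidirect.ext (fn_dpow f (n + 1) x.fst)
        (dpAct_compat M N (Hom.fn f) g (fn_dpow f) hg n x.fst x.snd))

@[simp] theorem fn_semidirectMap {A B : DivPowAlg.{v, u} F} (M : A.UMod) (N : B.UMod) (f : A ⟶ B)
    (g : M →ₗ[F] N) (hg) (x : Semidirect M) :
    Hom.fn (semidirectMap M N f g hg) x = (⟨Hom.fn f x.fst, g x.snd⟩ : Semidirect N) := rfl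

/-- The projection `A ⋉_p M ⟶ A`. -/
def sdProj (A : DivPowAlg.{v, u} F) (M : A.UMod) : A.semidirect M ⟶ A :=
  mkHom (A := A.semidirect M) (fun x : Semidirect M => x.fst) (fun _ _ => rfl) (fun _ _ => rfl)
    (fun _ _ => rfl) (fun n (x : Semidirect M) => by rw [dpow_semidirect])

@[simp] theorem fn_sdProj (A : DivPowAlg.{v, u} F) (M : A.UMod) (x : Semidirect M) :
    Hom.fn (A.sdProj M) x = x.fst := rfl

/-- The zero section `A ⟶ A ⋉_p M`, `a ↦ (a, 0)`. -/
def sdZero (A : DivPowAlg.{v, u} F) (M : A.UMod) : A ⟶ A.semidirect M :=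
  mkHom (B := A.semidirect M) (fun a : A => (⟨a, 0⟩ : Semidirect M))
    (fun c _ => Semidirect.ext rfl (smul_zero c).symm)
    (fun _ _ => Semidirect.ext rfl (add_zero (0 : M)).symm)
    (fun (a b : A) => Semidirect.ext rfl (by
      change (0 : M) = M.act a 0 + M.act b 0
      rw [map_zero, map_zero, add_zero]))
    (fun n a => by
      rw [dpow_semidirect]
      exact Semidirect.ext rfl (map_zero _).symm)

@[simp] theorem fn_sdZero (A : DivPowAlg.{v, u} F) (M : A.UMod) (a : A) :
    Hom.fn (A.sdZero M) a = (⟨a, 0⟩ : Semidirect M) := rfl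

/-! ### The algebraic tangent structure -/

/-- `T A = A ⋉_p A`, where `A` is seen as a `U(A)`-module with trivial `p`-map. -/
abbrev tangent (A : DivPowAlg.{v, u} F) : DivPowAlg.{v, u} F :=
  A.semidirect (AlgMod.regular F A)

/-- The tangent bundle functor: `T A = A ⋉_p A` and `T f = f × f`. -/
abbrev tangentFunctor (F : Type v) [Field F] : DivPowAlg.{v, u} F ⥤ DivPowAlg.{v, u} F where
  obj A := A.tangent
  map {A B} f := semidirectMap (AlgMod.regular F A) (AlgMod.regular F B) f
    { toFun := Hom.fn f, map_add' := fn_add f, map_smul' := fn_smul f } (fn_mul f)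

/-- The elements of `T A`. -/
def tpair {A : DivPowAlg.{v, u} F} (a b : A) : A.tangent :=
  (⟨a, b⟩ : Semidirect (AlgMod.regular F A))
/-- The base point of a tangent vector. -/
def tfst {A : DivPowAlg.{v, u} F} (x : A.tangent) : A :=
  Semidirect.fst (M := AlgMod.regular F A) x
/-- The vector part of a tangent vector. -/
def tsnd {A : DivPowAlg.{v, u} F} (x : A.tangent) : A :=
  Semidirect.snd (M := AlgMod.regular F A) x

section
variable {A : DivPowAlg.{v, u} F}
@[simp] theorem tfst_tpair (a b : A) : tfst (tpair a b) = a := rfl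
@[simp] theorem tsnd_tpair (a b : A) : tsnd (tpair a b) = b := rfl
@[simp] theorem tpair_eta (x : A.tangent) : tpair (tfst x) (tsnd x) = x := rfl
theorem tangent_ext {x y : A.tangent} (h1 : tfst x = tfst y) (h2 : tsnd x = tsnd y) : x = y :=
  Semidirect.ext h1 h2
theorem dpow_tangent (n : ℕ) (x : A.tangent) : A.tangent.dp.dpow (n + 1) x =
    tpair (A.dp.dpow (n + 1) (tfst x)) (A.dp.dpAct (AlgMod.regular F A) n (tfst x) (tsnd x)) :=
  dpow_semidirect A (AlgMod.regular F A) n x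
theorem tfst_mul (x y : A.tangent) : tfst (x * y) = tfst x * tfst y := rfl
theorem tsnd_mul (x y : A.tangent) : tsnd (x * y) = tfst x * tsnd y + tfst y * tsnd x := rfl
@[simp] theorem fn_tangentFunctor_map {B : DivPowAlg.{v, u} F} (f : A ⟶ B) (x : A.tangent) :
    Hom.fn ((tangentFunctor F).map f) x = tpair (Hom.fn f (tfst x)) (Hom.fn f (tsnd x)) := rfl
end

section Limits

variable {J : Type} [SmallCategory J]

theorem IsElementwiseLimit.of_isLimit {K : J ⥤ DivPowAlg.{v, u} F} {c : Cone K} (hc : IsLimit c) :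
    IsElementwiseLimit c := by
  intro s hs
  have hS := (Sections.cone_isElementwiseLimit K).nonempty_isLimit.some
  let e := hc.conePointUniqueUpToIso hS
  have he : ∀ j x, Hom.fn (c.π.app j) (Hom.fn e.inv x) = Hom.fn ((Sections.cone K).π.app j) x :=
    fun j x => by
      rw [← fn_comp, hc.conePointUniqueUpToIso_inv_comp hS]
  have he' : ∀ j x, Hom.fn ((Sections.cone K).π.app j) (Hom.fn e.hom x) = Hom.fn (c.π.app j) x :=
    fun j x => by
      rw [← fn_comp, hc.conePointUniqueUpToIso_hom_comp hS]
  refine ⟨Hom.fn e.inv (⟨s, hs⟩ : Sections K), fun j => he j _, fun y hy => ?_⟩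
  have h1 : Hom.fn e.hom y = (⟨s, hs⟩ : Sections K) :=
    Sections.ext fun j => (he' j y).trans (hy j)
  rw [← h1, ← fn_comp, e.hom_inv_id, fn_id]

theorem IsElementwiseLimit.mapTangent {K : J ⥤ DivPowAlg.{v, u} F} {c : Cone K}
    (h : IsElementwiseLimit c) : IsElementwiseLimit ((tangentFunctor F).mapCone c) := by
  intro s hs
  obtain ⟨x, hx, -⟩ := h (fun j => tfst (s j)) fun i j f => congrArg tfst (hs f)
  obtain ⟨y, hy, -⟩ := h (fun j => tsnd (s j)) fun i j f => congrArg tsnd (hs f)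
  refine ⟨tpair x y, fun j => tangent_ext (hx j) (hy j), fun z hz => tangent_ext ?_ ?_⟩
  · exact h.ext fun j => (congrArg tfst (hz j)).trans (hx j).symm
  · exact h.ext fun j => (congrArg tsnd (hz j)).trans (hy j).symm

instance : PreservesLimitsOfShape J (tangentFunctor.{v, u} F) where
  preservesLimit := ⟨fun hc => (IsElementwiseLimit.of_isLimit hc).mapTangent.nonempty_isLimit⟩

instance (m : ℕ) : PreservesLimitsOfShape J (iterFunctor (tangentFunctor.{v, u} F) m) := by
  induction m with
  | zero => exact inferInstanceAs (PreservesLimitsOfShape J (𝟭 (DivPowAlg.{v, u} F)))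
  | succ m ih =>
    exact inferInstanceAs (PreservesLimitsOfShape J
      (iterFunctor (tangentFunctor.{v, u} F) m ⋙ tangentFunctor.{v, u} F))

end Limits

theorem hasFiberPowers {E A : DivPowAlg.{v, u} F} (q : E ⟶ A) :
    HasFiberPowers (tangentFunctor F) q :=
  ⟨fun _ => inferInstance, fun _ _ => inferInstance⟩

theorem iter_map_isPullback {P X Y Z : DivPowAlg.{v, u} F} {a : P ⟶ X} {b : P ⟶ Y} {f : X ⟶ Z}
    {g : Y ⟶ Z} (h : IsPullback a b f g) (m : ℕ) :
    IsPullback ((iterFunctor (tangentFunctor F) m).map a) ((iterFunctor (tangentFunctor F) m).map b)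
      ((iterFunctor (tangentFunctor F) m).map f) ((iterFunctor (tangentFunctor F) m).map g) :=
  h.map _

theorem isPullback_of_elements {P X Y Z : DivPowAlg.{v, u} F} {a : P ⟶ X} {b : P ⟶ Y} {f : X ⟶ Z}
    {g : Y ⟶ Z} (w : a ≫ f = b ≫ g)
    (h : ∀ x y, Hom.fn f x = Hom.fn g y → ∃ z, Hom.fn a z = x ∧ Hom.fn b z = y)
    (hinj : ∀ z z', Hom.fn a z = Hom.fn a z' → Hom.fn b z = Hom.fn b z' → z = z') :
    IsPullback a b f g := by
  have hs : ∀ (s : PullbackCone f g) (t : s.pt),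
      ∃ z, Hom.fn a z = Hom.fn s.fst t ∧ Hom.fn b z = Hom.fn s.snd t := fun s t =>
    h _ _ (by rw [← fn_comp, ← fn_comp, s.condition])
  choose l hl using hs
  refine ⟨⟨w⟩, ⟨PullbackCone.IsLimit.mk _
    (fun s => mkHom (l s)
      (fun r t => hinj _ _ (by simp only [hl, fn_smul]) (by simp only [hl, fn_smul]))
      (fun t t' => hinj _ _ (by simp only [hl, fn_add]) (by simp only [hl, fn_add]))
      (fun t t' => hinj _ _ (by simp only [hl, fn_mul]) (by simp only [hl, fn_mul]))
      (fun n t => hinj _ _ (by simp only [hl, fn_dpow]) (by simp only [hl, fn_dpow])))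
    (fun s => hom_ext fun t => (hl s t).1) (fun s => hom_ext fun t => (hl s t).2)
    (fun s m h1 h2 => hom_ext fun t => hinj _ _ ?_ ?_)⟩⟩
  · rw [fn_mkHom, (hl s t).1, ← h1, fn_comp]
  · rw [fn_mkHom, (hl s t).2, ← h2, fn_comp]

/-! ### `A ⋉_p M` as an additive bundle over `A`, and its lift -/

section

variable (A : DivPowAlg.{v, u} F) (M : A.UMod)

/-- The maps `(a, m, m') ↦ (a, g (m, m'))`. -/
def sdSquareMap (g : M.square →ₗ[F] M)
    (hg : ∀ (a : A) (m : M.square), g (M.square.act a m) = M.act a (g m)) :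
    A.semidirect M.square ⟶ A.semidirect M :=
  semidirectMap M.square M (𝟙 A) g hg

/-- The additive bundle `A ⋉_p M` over `A`: addition `(a, m, m') ↦ (a, m + m')`, zero
`a ↦ (a, 0)`. -/
def sdAdditive : AdditiveData (A.sdProj M) where
  pow₂ := A.semidirect M.square
  fst := A.sdSquareMap M (LinearMap.fst F M M) (fun _ _ => rfl)
  snd := A.sdSquareMap M (LinearMap.snd F M M) (fun _ _ => rfl)
  sq := isPullback_of_elements rfl
    (fun (x y : Semidirect M) (h : x.fst = y.fst) =>
      ⟨(⟨x.fst, (x.snd, y.snd)⟩ : Semidirect M.square), rfl, Semidirect.ext h rfl⟩)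
    (fun (_ _ : Semidirect M.square) h1 h2 => Semidirect.ext
      (congrArg (Semidirect.fst (M := M)) h1) (Prod.ext (congrArg (Semidirect.snd (M := M)) h1)
        (congrArg (Semidirect.snd (M := M)) h2)))
  add := A.sdSquareMap M (LinearMap.fst F M M + LinearMap.snd F M M)
    (fun a m => (map_add (M.act a) m.1 m.2).symm)
  zero := A.sdZero M

theorem fn_sdAdditive_fst (z : Semidirect M.square) :
    Hom.fn (A.sdAdditive M).fst z = (⟨z.fst, z.snd.1⟩ : Semidirect M) := rfl
theorem fn_sdAdditive_snd (z : Semidirect M.square) :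
    Hom.fn (A.sdAdditive M).snd z = (⟨z.fst, z.snd.2⟩ : Semidirect M) := rfl
theorem fn_sdAdditive_add (z : Semidirect M.square) :
    Hom.fn (A.sdAdditive M).add z = (⟨z.fst, z.snd.1 + z.snd.2⟩ : Semidirect M) := rfl

/-- Addition of elements of `A ⋉_p M` in the fibre direction. -/
def sdAdd (x y : A.semidirect M) : A.semidirect M :=
  (⟨Semidirect.fst (M := M) x, Semidirect.snd (M := M) x + Semidirect.snd (M := M) y⟩ :
    Semidirect M)

theorem sdAdd_of (z : (A.semidirect M.square).carrier) : Hom.fn (A.sdAdditive M).add z =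
    A.sdAdd M (Hom.fn (A.sdAdditive M).fst z) (Hom.fn (A.sdAdditive M).snd z) := rfl

theorem fn_sd_sum {X : DivPowAlg.{v, u} F} (x y : X ⟶ A.semidirect M)
    (h : x ≫ A.sdProj M = y ≫ A.sdProj M) (t : X) :
    Hom.fn ((A.sdAdditive M).sum x y h) t = A.sdAdd M (Hom.fn x t) (Hom.fn y t) := by
  exact (sdAdd_of A M (Hom.fn ((A.sdAdditive M).sq.lift x y h) t)).trans
    (congrArg₂ (A.sdAdd M)
      (congrArg (fun k : X ⟶ A.semidirect M => Hom.fn k t) ((A.sdAdditive M).sq.lift_fst x y h))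
      (congrArg (fun k : X ⟶ A.semidirect M => Hom.fn k t) ((A.sdAdditive M).sq.lift_snd x y h)))

theorem fn_sd_map_sum {X : DivPowAlg.{v, u} F} (x y : X ⟶ (A.semidirect M).tangent)
    (h : x ≫ (tangentFunctor F).map (A.sdProj M) = y ≫ (tangentFunctor F).map (A.sdProj M))
    (t : X) :
    Hom.fn (((A.sdAdditive M).map (tangentFunctor F) (hasFiberPowers _)).sum x y h) t =
      tpair (A.sdAdd M (tfst (Hom.fn x t)) (tfst (Hom.fn y t)))
        (A.sdAdd M (tsnd (Hom.fn x t)) (tsnd (Hom.fn y t))) := by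
  have key : ∀ z : (A.semidirect M.square).tangent,
      Hom.fn ((A.sdAdditive M).map (tangentFunctor F) (hasFiberPowers _)).add z =
      tpair (A.sdAdd M
          (tfst (Hom.fn ((A.sdAdditive M).map (tangentFunctor F) (hasFiberPowers _)).fst z))
          (tfst (Hom.fn ((A.sdAdditive M).map (tangentFunctor F) (hasFiberPowers _)).snd z)))
        (A.sdAdd M
          (tsnd (Hom.fn ((A.sdAdditive M).map (tangentFunctor F) (hasFiberPowers _)).fst z))
          (tsnd (Hom.fn ((A.sdAdditive M).map (tangentFunctor F) (hasFiberPowers _)).snd z))) :=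
    fun _ => rfl
  refine (key (Hom.fn (((A.sdAdditive M).map (tangentFunctor F) (hasFiberPowers _)).sq.lift
    x y h) t)).trans ?_
  have h1 := congrArg (fun k : X ⟶ (A.semidirect M).tangent => Hom.fn k t)
    (((A.sdAdditive M).map (tangentFunctor F) (hasFiberPowers _)).sq.lift_fst x y h)
  have h2 := congrArg (fun k : X ⟶ (A.semidirect M).tangent => Hom.fn k t)
    (((A.sdAdditive M).map (tangentFunctor F) (hasFiberPowers _)).sq.lift_snd x y h)
  exact congrArg₂ tpair (congrArg₂ (A.sdAdd M) (congrArg tfst h1) (congrArg tfst h2))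
    (congrArg₂ (A.sdAdd M) (congrArg tsnd h1) (congrArg tsnd h2))

theorem sd_isAdditiveBundle : (A.sdAdditive M).IsAdditiveBundle where
  add_proj := rfl
  zero_proj := rfl
  sum_assoc X x y z hxy hyz := hom_ext fun t => by
    simp only [fn_sd_sum]
    exact Semidirect.ext rfl (add_assoc _ _ _)
  sum_comm X x y hxy := hom_ext fun t => by
    simp only [fn_sd_sum]
    exact Semidirect.ext (congrArg (fun k => Hom.fn k t) hxy) (add_comm _ _)
  zero_sum X x := hom_ext fun t => by
    simp only [fn_sd_sum]
    exact Semidirect.ext rfl (zero_add _)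

theorem dpAct_sdZero (n : ℕ) (a : A) (m : M) :
    (A.semidirect M).dp.dpAct (AlgMod.regular F (A.semidirect M)) n (⟨a, 0⟩ : Semidirect M)
      (⟨0, m⟩ : Semidirect M) = (⟨0, A.dp.dpAct M n a m⟩ : Semidirect M) := by
  cases n with
  | zero => rfl
  | succ n =>
    refine (congrArg (fun z : Semidirect M => z * (⟨0, m⟩ : Semidirect M))
      (dpow_semidirect A M n (⟨a, 0⟩ : Semidirect M))).trans ?_
    refine Semidirect.ext (mul_zero _) ?_
    change M.act (A.dp.dpow (n + 1) a) m + M.act 0 (A.dp.dpAct M n a 0) = _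
    rw [map_zero, map_zero]
    exact add_zero _

/-- The lift `A ⋉_p M ⟶ T (A ⋉_p M)`, `(a, m) ↦ ((a, 0), (0, m))`. -/
def sdLift : A.semidirect M ⟶ (A.semidirect M).tangent :=
  mkHom (A := A.semidirect M) (B := (A.semidirect M).tangent)
    (fun x : Semidirect M => tpair (A := A.semidirect M) (⟨x.fst, 0⟩ : Semidirect M)
      (⟨0, x.snd⟩ : Semidirect M))
    (fun c _ => tangent_ext (Semidirect.ext rfl (smul_zero c).symm)
      (Semidirect.ext (smul_zero c).symm rfl))
    (fun _ _ => tangent_ext (Semidirect.ext rfl (add_zero (0 : M)).symm)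
      (Semidirect.ext (add_zero (0 : A)).symm rfl))
    (fun (x y : Semidirect M) => tangent_ext
      (Semidirect.ext rfl (by
        change (0 : M) = M.act x.fst 0 + M.act y.fst 0
        rw [map_zero, map_zero, add_zero]))
      (Semidirect.ext (by
        change (0 : A) = x.fst * 0 + y.fst * 0
        rw [mul_zero, mul_zero, add_zero]) (by
        change M.act x.fst y.snd + M.act y.fst x.snd =
          (M.act x.fst y.snd + M.act 0 0) + (M.act y.fst x.snd + M.act 0 0)
        rw [map_zero, add_zero, add_zero])))
    (fun n (x : Semidirect M) => by
      have e := dpow_semidirect A M n x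
      have f1 : Semidirect.fst (M := M) ((A.semidirect M).dp.dpow (n + 1) x) =
        A.dp.dpow (n + 1) x.fst := congrArg (Semidirect.fst (M := M)) e
      have f2 : Semidirect.snd (M := M) ((A.semidirect M).dp.dpow (n + 1) x) =
        A.dp.dpAct M n x.fst x.snd := congrArg (Semidirect.snd (M := M)) e
      have e0 : (⟨A.dp.dpow (n + 1) x.fst, 0⟩ : Semidirect M) =
          ⟨A.dp.dpow (n + 1) x.fst, A.dp.dpAct M n x.fst 0⟩ :=
        Semidirect.ext rfl (map_zero _).symm
      have e1 := e0.trans (dpow_semidirect A M n (⟨x.fst, 0⟩ : Semidirect M)).symm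
      have e2 := (dpAct_sdZero A M n x.fst x.snd).symm
      have e3 := dpow_tangent (A := A.semidirect M) n
        (tpair (⟨x.fst, 0⟩ : Semidirect M) (⟨0, x.snd⟩ : Semidirect M))
      refine Eq.trans ?_ e3.symm
      rw [f1, f2]
      exact congrArg₂ (tpair (A := A.semidirect M)) e1 e2)

theorem fn_sdLift (x : Semidirect M) : Hom.fn (A.sdLift M) x =
    tpair (A := A.semidirect M) (⟨x.fst, 0⟩ : Semidirect M) (⟨0, x.snd⟩ : Semidirect M) := rfl

theorem sd_lift_additive : (A.sdAdditive M).IsAdditiveMap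
    ((A.sdAdditive M).map (tangentFunctor F) (hasFiberPowers _)) (A.sdLift M)
    (A.sdZero (AlgMod.regular F A)) where
  proj := rfl
  zero := rfl
  add := hom_ext fun t => Eq.symm ((fn_sd_map_sum A M _ _ _ t).trans
    (tangent_ext (Semidirect.ext rfl (add_zero (0 : M))) rfl))

theorem sd_lift_additive' : (A.sdAdditive M).IsAdditiveMap
    ((A.semidirect M).sdAdditive (AlgMod.regular F (A.semidirect M))) (A.sdLift M)
    (A.sdZero M) where
  proj := rfl
  zero := rfl
  add := hom_ext fun t => Eq.symm ((fn_sd_sum _ _ _ _ _ t).trans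
    (tangent_ext rfl (Semidirect.ext (add_zero (0 : A)) rfl)))

theorem sd_lift_lift : A.sdLift M ≫ (tangentFunctor F).map (A.sdLift M) =
    A.sdLift M ≫ (A.semidirect M).sdLift (AlgMod.regular F (A.semidirect M)) := rfl

theorem sd_universal : (A.sdAdditive M).IsUniversalLift (tangentFunctor F) (hasFiberPowers _)
    (A.sdZero (AlgMod.regular F A)) ((A.semidirect M).sdZero (AlgMod.regular F (A.semidirect M)))
    (A.sdLift M) where
  comm := rfl
  isPullback m := by
    refine iter_map_isPullback (isPullback_of_elements ?_ ?_ ?_) m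
    · exact hom_ext fun t => Eq.symm ((congrArg (Hom.fn ((tangentFunctor F).map (A.sdProj M)))
        (fn_sd_map_sum A M ((A.sdAdditive M).fst ≫ A.sdLift M) ((A.sdAdditive M).snd ≫
          (A.semidirect M).sdZero (AlgMod.regular F (A.semidirect M))) rfl t)).trans rfl)
    · intro a y h
      exact ⟨(⟨a, (Semidirect.snd (M := M) (tsnd y), Semidirect.snd (M := M) (tfst y))⟩ :
        Semidirect M.square), rfl, (fn_sd_map_sum A M _ _ _ _).trans
          (tangent_ext (Semidirect.ext (congrArg tfst h) (zero_add _))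
            (Semidirect.ext (congrArg tsnd h) (add_zero _)))⟩
    · intro z z' h1 h2
      have h3 := (fn_sd_map_sum A M _ _ _ z).symm.trans (h2.trans (fn_sd_map_sum A M _ _ _ z'))
      have e1 := congrArg (fun w => Semidirect.snd (M := M) (tfst w)) h3
      have e2 := congrArg (fun w => Semidirect.snd (M := M) (tsnd w)) h3
      refine Semidirect.ext h1 (Prod.ext ?_ ?_)
      · exact (add_zero _).symm.trans (Eq.trans e2 (add_zero _))
      · exact (zero_add _).symm.trans (Eq.trans e1 (zero_add _))

end

/-- The canonical flip `((a, b), (c, d)) ↦ ((a, c), (b, d))`. -/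
def tangentFlip (A : DivPowAlg.{v, u} F) : A.tangent.tangent ⟶ A.tangent.tangent :=
  mkHom (A := A.tangent.tangent) (B := A.tangent.tangent)
    (fun x => tpair (tpair (tfst (tfst x)) (tfst (tsnd x))) (tpair (tsnd (tfst x)) (tsnd (tsnd x))))
    (fun _ _ => rfl) (fun _ _ => rfl)
    (fun x y => by
      refine tangent_ext (tangent_ext rfl rfl) (tangent_ext rfl ?_)
      change (tfst (tfst x) * tsnd (tsnd y) + tfst (tsnd y) * tsnd (tfst x)) +
        (tfst (tfst y) * tsnd (tsnd x) + tfst (tsnd x) * tsnd (tfst y)) =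
        (tfst (tfst x) * tsnd (tsnd y) + tsnd (tfst y) * tfst (tsnd x)) +
        (tfst (tfst y) * tsnd (tsnd x) + tsnd (tfst x) * tfst (tsnd y))
      rw [mul_comm (tfst (tsnd y)), mul_comm (tfst (tsnd x))]
      abel)
    (fun n x => by
      have key : ∀ y : A.tangent.tangent, A.tangent.tangent.dp.dpow (n + 1) y =
          tpair (tpair (A.dp.dpow (n + 1) (tfst (tfst y)))
            (A.dp.dpAct (AlgMod.regular F A) n (tfst (tfst y)) (tsnd (tfst y))))
          (tpair (A.dp.dpAct (AlgMod.regular F A) n (tfst (tfst y)) (tfst (tsnd y)))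
            (match n with
              | 0 => tsnd (tsnd y)
              | k + 1 => A.dp.dpow (k + 1) (tfst (tfst y)) * tsnd (tsnd y) + tfst (tsnd y) *
                  tsnd (tpair (tfst (tfst y))
                    (A.dp.dpAct (AlgMod.regular F A) k (tfst (tfst y)) (tsnd (tfst y)))))) := by
        intro y
        rw [dpow_tangent]
        refine congrArg₂ tpair (dpow_tangent n (tfst y)) ?_
        cases n with
        | zero => rfl
        | succ k =>
          exact (congrArg (fun z : A.tangent => z * tsnd y) (dpow_tangent k (tfst y))).trans rfl
      rw [key, key]
      refine congrArg₂ tpair rfl (congrArg₂ tpair rfl ?_)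
      rcases n with _ | _ | k
      · rfl
      · exact congrArg₂ (· + ·) rfl (mul_comm (tfst (tsnd x)) (tsnd (tfst x)))
      · exact congrArg₂ (· + ·) rfl (mul_left_comm (tfst (tsnd x))
          (A.dp.dpow (k + 1) (tfst (tfst x))) (tsnd (tfst x)) |>.trans (by
            rw [mul_comm (tfst (tsnd x)), mul_left_comm]
            rfl)))

@[simp] theorem fn_tangentFlip (A : DivPowAlg.{v, u} F) (x : A.tangent.tangent) :
    Hom.fn A.tangentFlip x = tpair (tpair (tfst (tfst x)) (tfst (tsnd x)))
      (tpair (tsnd (tfst x)) (tsnd (tsnd x))) := rfl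

/-- The negative `(a, b) ↦ (a, -b)`. -/
def tangentNeg (A : DivPowAlg.{v, u} F) : A.tangent ⟶ A.tangent :=
  semidirectMap (AlgMod.regular F A) (AlgMod.regular F A) (𝟙 A) (-LinearMap.id)
    (fun a b => (mul_neg (a : A) (b : A)).symm)

@[simp] theorem fn_tangentNeg (A : DivPowAlg.{v, u} F) (x : A.tangent) :
    Hom.fn A.tangentNeg x = tpair (tfst x) (-tsnd x) := rfl

/-- The algebraic tangent structure on the category of divided power algebras: `T A = A ⋉_p A`,
with projection `(a, b) ↦ a`, sum `(a, b, c) ↦ (a, b + c)`, zero `a ↦ (a, 0)`, vertical lift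
`(a, b) ↦ ((a, 0), (0, b))`, flip `((a, b), (c, d)) ↦ ((a, c), (b, d))` and negative
`(a, b) ↦ (a, -b)`. -/
abbrev algebraicTangent (F : Type v) [Field F] : TangentStructure (DivPowAlg.{v, u} F) where
  T := tangentFunctor F
  p := { app := fun A => A.sdProj (AlgMod.regular F A), naturality := fun _ _ _ => rfl }
  powers _ := hasFiberPowers _
  bundle A := A.sdAdditive (AlgMod.regular F A)
  isAdditiveBundle A := A.sd_isAdditiveBundle _
  map_additive _ _ f :=
    { proj := rfl
      zero := hom_ext fun _ => tangent_ext rfl (fn_zero f)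
      add := hom_ext fun t => Eq.symm ((fn_sd_sum _ _ _ _ _ t).trans
        (tangent_ext rfl (fn_add f _ _).symm)) }
  lift :=
    { app := fun A => A.sdLift (AlgMod.regular F A)
      naturality := fun _ _ f => hom_ext fun _ => tangent_ext
        (tangent_ext rfl (fn_zero f).symm) (tangent_ext (fn_zero f).symm rfl) }
  flip := { app := fun A => A.tangentFlip, naturality := fun _ _ _ => rfl }
  neg :=
    { app := fun A => A.tangentNeg
      naturality := fun _ _ f => hom_ext fun t => tangent_ext rfl (fn_neg f (tsnd t)).symm }
  lift_additive A := A.sd_lift_additive _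
  flip_additive _ :=
    { proj := rfl
      zero := rfl
      add := hom_ext fun t => Eq.symm ((fn_sd_sum _ _ _ _ _ t).trans rfl) }
  lift_lift _ := rfl
  flip_flip _ := rfl
  lift_flip _ := rfl
  flip_hexagon _ := rfl
  lift_flip_flip _ := rfl
  universal A := A.sd_universal _
  neg_proj _ := rfl
  neg_add _ := hom_ext fun t => (fn_sd_sum _ _ _ _ _ t).trans
    (tangent_ext rfl (neg_add_cancel (tsnd t)))

end DivPowAlg

/-! ### Differential bundles over `A` and `U(A)`-modules -/

namespace DivPowAlg

variable {F : Type v} [Field F]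

/-- The category `DBun_A` of differential bundles over `A` in the algebraic tangent structure. -/
abbrev DBun (A : DivPowAlg.{v, u} F) : Type (max v (u + 1)) :=
  DifferentialBundle (algebraicTangent.{v, u} F) A

/-- A morphism as a linear map. -/
def Hom.lin {A B : DivPowAlg.{v, u} F} (f : A ⟶ B) : A →ₗ[F] B where
  toFun := Hom.fn f
  map_add' := fn_add f
  map_smul' := fn_smul f

/-- The kernel of `q : E ⟶ A`, with the action `a • k = z a * k` of `U(A)` through a map
`z : A ⟶ E`. -/
abbrev kerModule {A E : DivPowAlg.{v, u} F} (q : E ⟶ A) (z : A ⟶ E) : A.UMod where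
  carrier := LinearMap.ker (Hom.lin q)
  act :=
    { toFun := fun a =>
        (LinearMap.mulLeft F (Hom.fn z a)).restrict (p := LinearMap.ker (Hom.lin q))
          (q := LinearMap.ker (Hom.lin q)) (fun k (hk : Hom.fn q k = 0) =>
            (fn_mul q (Hom.fn z a) k).trans (by rw [hk, mul_zero]))
      map_smul' := fun c a => LinearMap.ext fun k => Subtype.ext (by
        change Hom.fn z (c • a) * k.1 = c • (Hom.fn z a * k.1)
        rw [fn_smul, smul_mul_assoc])
      map_zero' := LinearMap.ext fun k => Subtype.ext (by
        change Hom.fn z 0 * k.1 = 0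
        rw [fn_zero, zero_mul])
      map_add' := fun a b => LinearMap.ext fun k => Subtype.ext (by
        change Hom.fn z (a + b) * k.1 = Hom.fn z a * k.1 + Hom.fn z b * k.1
        rw [fn_add, add_mul])
      map_mul' := fun a b => LinearMap.ext fun k => Subtype.ext (by
        change Hom.fn z (a * b) * k.1 = Hom.fn z a * (Hom.fn z b * k.1)
        rw [fn_mul, mul_assoc]) }

variable (A : DivPowAlg.{v, u} F)

/-- The functor sending a differential bundle `q : E ⟶ A` to `ker q`, on which `U(A)` acts through
the zero section of the bundle, and a morphism to its restriction to the kernels. -/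
abbrev kerFunctor : A.DBun ⥤ A.UMod where
  obj E := kerModule E.proj E.bundle.zero
  map {E E'} f :=
    { toLin := (Hom.lin (DifferentialBundle.Hom.map f)).restrict
        (p := LinearMap.ker (Hom.lin E.proj)) (q := LinearMap.ker (Hom.lin E'.proj))
        (fun k (hk : Hom.fn E.proj k = 0) => by
          change Hom.fn E'.proj (Hom.fn (DifferentialBundle.Hom.map f) k) = 0
          rw [← fn_comp, DifferentialBundle.Hom.map_proj, hk])
      map_act := fun a k => Subtype.ext (by
        change Hom.fn (DifferentialBundle.Hom.map f) (Hom.fn E.bundle.zero a * k.1) =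
          Hom.fn E'.bundle.zero a * Hom.fn (DifferentialBundle.Hom.map f) k.1
        rw [fn_mul, ← fn_comp, DifferentialBundle.Hom.zero_map]) }
  map_id _ := rfl
  map_comp _ _ := rfl

/-- The differential bundle `A ⋉_p M ⟶ A`, `(a, m) ↦ a`, for a `U(A)`-module `M` with trivial
`p`-map. -/
abbrev semidirectBundle (M : A.UMod) : A.DBun where
  total := A.semidirect M
  proj := A.sdProj M
  powers := hasFiberPowers _
  bundle := A.sdAdditive M
  isAdditiveBundle := A.sd_isAdditiveBundle M
  lift := A.sdLift M
  lift_additive := A.sd_lift_additive M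
  lift_additive' := A.sd_lift_additive' M
  lift_lift := A.sd_lift_lift M
  universal := A.sd_universal M

/-- The functor `A ⋉_p -`, sending `M` to `A ⋉_p M` (with trivial `p`-map) and `g : M ⟶ N` to
`(a, m) ↦ (a, g m)`. -/
abbrev semidirectFunctor : A.UMod ⥤ A.DBun where
  obj M := A.semidirectBundle M
  map {M N} g :=
    { map := semidirectMap M N (𝟙 A) (AlgMod.Hom.toLin g) (AlgMod.Hom.map_act g)
      map_proj := rfl
      map_lift := hom_ext fun _ => tangent_ext
        (Semidirect.ext rfl (map_zero (AlgMod.Hom.toLin g)).symm) rfl }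
  map_id _ := rfl
  map_comp _ _ := rfl

end DivPowAlg

end

/-!
Let `q : E ⟶ A` be a differential bundle with zero section `ζ` and lift `λ : E ⟶ T E = E ⋉_p E`.
Everything rests on the second component of `λ`, the *vertical derivation* `D : E → E`
(`vert` below). Being a morphism over `q ≫ ζ`, the lift has the form `λ e = (ζ (q e), D e)`, and

* `q (D e) = 0`, `D (ζ a) = 0` and `D (D e) = D e`, by additivity of `λ` and `T(λ) ∘ λ = l ∘ λ`;
* the universal square sends `(x, y)` with `q x = q y` to `(y, D x)` (`fn_universal`), so its being
  a pullback makes `D` injective on the fibres of `q`.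

Hence the idempotent `D` is the identity on `ker q` (`vert_eq_self`).
Since `λ` is a morphism of divided power algebras, the compatibility of `D` with products and
divided powers says exactly that `e ↦ (q e, D e)` is a morphism `E ⟶ A ⋉_p ker q`
(`toSemidirectKer`); in particular products and higher divided powers vanish on `ker q` without any
separate argument. It is bijective with inverse `(a, k) ↦ ζ a + k`, commutes with the lifts, and is
natural in `E`: this is the unit of the equivalence. The counit is `ker (A ⋉_p M ⟶ A) ≅ M`.
-/

/-! ### Isomorphisms, and elements of pullbacks -/

namespace DifferentialBundle

/-- A morphism of differential bundles over `A` whose underlying morphism is an isomorphism is an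
isomorphism. -/
theorem isIso_of_isIso_map {C : Type*} [Category C] {𝕋 : TangentStructure C} {A : C}
    {E E' : DifferentialBundle 𝕋 A} (f : E ⟶ E') [IsIso (Hom.map f)] : IsIso f :=
  ⟨⟨{ map := inv (Hom.map f)
      map_proj := by rw [IsIso.inv_comp_eq, Hom.map_proj]
      map_lift := by
        rw [IsIso.inv_comp_eq, ← Category.assoc, Hom.map_lift, Category.assoc, ← 𝕋.T.map_comp,
          IsIso.hom_inv_id, 𝕋.T.map_id, Category.comp_id] },
    hom_ext (IsIso.hom_inv_id _), hom_ext (IsIso.inv_hom_id _)⟩⟩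

end DifferentialBundle

namespace DivPowAlg

variable {F : Type v} [Field F]

theorem isIso_of_bijective {A B : DivPowAlg.{v, u} F} (f : A ⟶ B)
    (hf : Function.Bijective (Hom.fn f)) : IsIso f := by
  choose g hg using hf.2
  refine ⟨mkHom g (fun c b => hf.1 ?_) (fun b b' => hf.1 ?_) (fun b b' => hf.1 ?_)
    (fun n b => hf.1 ?_), hom_ext fun a => hf.1 (hg _), hom_ext hg⟩
  · rw [fn_smul, hg, hg]
  · rw [fn_add, hg, hg, hg]
  · rw [fn_mul, hg, hg, hg]
  · rw [fn_dpow, hg, hg]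

/-- The underlying set of a pullback of divided power algebras is the pullback of the underlying
sets: elements are determined by their two projections. -/
theorem eq_of_isPullback {P X Y Z : DivPowAlg.{v, u} F} {a : P ⟶ X} {b : P ⟶ Y} {f : X ⟶ Z}
    {g : Y ⟶ Z} (h : IsPullback a b f g) {z z' : P} (ha : Hom.fn a z = Hom.fn a z')
    (hb : Hom.fn b z = Hom.fn b z') : z = z' := by
  refine (IsElementwiseLimit.of_isLimit h.isLimit).ext fun j => ?_
  rcases j with _ | _ | _
  · exact congrArg (Hom.fn f) ha
  · exact ha
  · exact hb

/-- Two elements of `X` and `Y` with the same image in `Z` come from an element of the pullback. -/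
theorem exists_of_isPullback {P X Y Z : DivPowAlg.{v, u} F} {a : P ⟶ X} {b : P ⟶ Y} {f : X ⟶ Z}
    {g : Y ⟶ Z} (h : IsPullback a b f g) (x : X) (y : Y) (hxy : Hom.fn f x = Hom.fn g y) :
    ∃ z, Hom.fn a z = x ∧ Hom.fn b z = y := by
  obtain ⟨z, hz, -⟩ := IsElementwiseLimit.of_isLimit h.isLimit
    (fun j => match j with
      | none => Hom.fn f x
      | some WalkingPair.left => x
      | some WalkingPair.right => y) (fun i j k => by
        rcases k with _ | (_ | _)
        · rcases i with _ | _ | _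
          all_goals exact congrArg (fun k => Hom.fn k _) ((cospan f g).map_id _)
        · rfl
        · exact hxy.symm)
  exact ⟨z, hz (some WalkingPair.left), hz (some WalkingPair.right)⟩

/-! ### The vertical derivation of a differential bundle -/

section Vert

variable {A : DivPowAlg.{v, u} F} (E : A.DBun)

/-- The zero laws of the addition of a differential bundle, read on elements of the fibre square. -/
theorem bundle_add_of_fst_eq_zero {t : E.bundle.pow₂}
    (h : Hom.fn E.bundle.fst t = Hom.fn E.bundle.zero (Hom.fn E.proj (Hom.fn E.bundle.snd t))) :
    Hom.fn E.bundle.add t = Hom.fn E.bundle.snd t := by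
  have hw : (E.bundle.snd ≫ E.proj ≫ E.bundle.zero) ≫ E.proj = E.bundle.snd ≫ E.proj := by
    simp only [Category.assoc, E.isAdditiveBundle.zero_proj, Category.comp_id]
  have h1 : E.bundle.sum _ _ hw = _ := E.isAdditiveBundle.zero_sum E.bundle.snd
  have h2 : Hom.fn E.bundle.add (Hom.fn (E.bundle.sq.lift _ _ hw) t) = Hom.fn E.bundle.snd t :=
    congrArg (fun k => Hom.fn k t) h1
  refine Eq.trans (congrArg (Hom.fn E.bundle.add) ?_) h2
  refine eq_of_isPullback E.bundle.sq (h.trans ?_) ?_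
  · exact (congrArg (fun k => Hom.fn k t) (E.bundle.sq.lift_fst _ _ hw)).symm
  · exact (congrArg (fun k => Hom.fn k t) (E.bundle.sq.lift_snd _ _ hw)).symm

theorem bundle_add_of_snd_eq_zero {t : E.bundle.pow₂}
    (h : Hom.fn E.bundle.snd t = Hom.fn E.bundle.zero (Hom.fn E.proj (Hom.fn E.bundle.fst t))) :
    Hom.fn E.bundle.add t = Hom.fn E.bundle.fst t := by
  have hw : E.bundle.fst ≫ E.proj = (E.bundle.fst ≫ E.proj ≫ E.bundle.zero) ≫ E.proj := by
    simp only [Category.assoc, E.isAdditiveBundle.zero_proj, Category.comp_id]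
  have h1 := (E.isAdditiveBundle.sum_comm _ _ hw).trans
    (E.isAdditiveBundle.zero_sum E.bundle.fst)
  have h2 : Hom.fn E.bundle.add (Hom.fn (E.bundle.sq.lift _ _ hw) t) = Hom.fn E.bundle.fst t :=
    congrArg (fun k => Hom.fn k t) h1
  refine Eq.trans (congrArg (Hom.fn E.bundle.add) ?_) h2
  refine eq_of_isPullback E.bundle.sq ?_ (h.trans ?_)
  · exact (congrArg (fun k => Hom.fn k t) (E.bundle.sq.lift_fst _ _ hw)).symm
  · exact (congrArg (fun k => Hom.fn k t) (E.bundle.sq.lift_snd _ _ hw)).symm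

/-- The second component `D` of the lift `e ↦ (ζ (q e), D e)` of a differential bundle. -/
def vert (e : E.total) : E.total := tsnd (Hom.fn E.lift e)

theorem proj_zero (a : A) : Hom.fn E.proj (Hom.fn E.bundle.zero a) = a :=
  congrArg (fun k => Hom.fn k a) E.isAdditiveBundle.zero_proj

theorem fn_lift (e : E.total) :
    Hom.fn E.lift e = tpair (Hom.fn E.bundle.zero (Hom.fn E.proj e)) (vert E e) :=
  tangent_ext (congrArg (fun k => Hom.fn k e) E.lift_additive'.proj) rfl

theorem proj_vert (e : E.total) : Hom.fn E.proj (vert E e) = 0 :=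
  congrArg (fun k => tsnd (Hom.fn k e)) E.lift_additive.proj

theorem vert_zero (a : A) : vert E (Hom.fn E.bundle.zero a) = 0 :=
  (congrArg (fun k => tsnd (Hom.fn k a)) E.lift_additive.zero).trans (fn_zero E.bundle.zero)

theorem vert_vert (e : E.total) : vert E (vert E e) = vert E e :=
  congrArg (fun k => tsnd (tsnd (Hom.fn k e))) E.lift_lift

theorem vert_smul (c : F) (e : E.total) : vert E (c • e) = c • vert E e :=
  congrArg tsnd (fn_smul E.lift c e)

theorem vert_add (e e' : E.total) : vert E (e + e') = vert E e + vert E e' :=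
  congrArg tsnd (fn_add E.lift e e')

theorem vert_mul (e e' : E.total) : vert E (e * e') =
    Hom.fn E.bundle.zero (Hom.fn E.proj e) * vert E e' +
      Hom.fn E.bundle.zero (Hom.fn E.proj e') * vert E e := by
  have h := congrArg tsnd (fn_mul E.lift e e')
  rw [fn_lift E e, fn_lift E e'] at h
  exact h

theorem vert_dpow (n : ℕ) (e : E.total) : vert E (E.total.dp.dpow (n + 1) e) =
    E.total.dp.dpAct (AlgMod.regular F E.total) n (Hom.fn E.bundle.zero (Hom.fn E.proj e))
      (vert E e) := by
  have h := congrArg tsnd ((fn_dpow E.lift (n + 1) e).trans (dpow_tangent n _))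
  rw [fn_lift E e] at h
  exact h

/-- The map `T(σ) ∘ ⟨λ ∘ π₁, z ∘ π₂⟩` of the universal square is `(x, y) ↦ (y, D x)`. -/
theorem fn_universal (t : E.bundle.pow₂) :
    Hom.fn ((E.bundle.map (tangentFunctor F) E.powers).sum (E.bundle.fst ≫ E.lift)
      (E.bundle.snd ≫ E.total.sdZero (AlgMod.regular F E.total)) E.universal.comm) t =
      tpair (Hom.fn E.bundle.snd t) (vert E (Hom.fn E.bundle.fst t)) := by
  set B := E.bundle.map (tangentFunctor F) E.powers with hB
  set w : E.bundle.pow₂.tangent := Hom.fn (B.sq.lift _ _ E.universal.comm) t with hw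
  have h1 : tpair (Hom.fn E.bundle.fst (tfst w)) (Hom.fn E.bundle.fst (tsnd w)) =
      Hom.fn E.lift (Hom.fn E.bundle.fst t) :=
    congrArg (fun k => Hom.fn k t) (B.sq.lift_fst _ _ E.universal.comm)
  have h2 : tpair (Hom.fn E.bundle.snd (tfst w)) (Hom.fn E.bundle.snd (tsnd w)) =
      tpair (Hom.fn E.bundle.snd t) 0 :=
    congrArg (fun k => Hom.fn k t) (B.sq.lift_snd _ _ E.universal.comm)
  rw [fn_lift] at h1
  have h11 : Hom.fn E.bundle.fst (tfst w) = _ := congrArg tfst h1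
  have h12 : Hom.fn E.bundle.fst (tsnd w) = _ := congrArg tsnd h1
  have h21 : Hom.fn E.bundle.snd (tfst w) = _ := congrArg tfst h2
  have h22 : Hom.fn E.bundle.snd (tsnd w) = _ := congrArg tsnd h2
  have hq : Hom.fn E.proj (Hom.fn E.bundle.fst t) = Hom.fn E.proj (Hom.fn E.bundle.snd t) :=
    congrArg (fun k => Hom.fn k t) E.bundle.sq.w
  rw [tfst_tpair] at h11 h21
  rw [tsnd_tpair] at h12 h22
  change tpair (Hom.fn E.bundle.add (tfst w)) (Hom.fn E.bundle.add (tsnd w)) = _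
  rw [bundle_add_of_fst_eq_zero E (by rw [h11, h21, hq]),
    bundle_add_of_snd_eq_zero E (by rw [h12, h22, proj_vert, fn_zero]), h12, h21]

/-- On each fibre of `q` the vertical derivation is injective: this is the uniqueness part of the
universality of the lift. -/
theorem vert_injOn_fiber {x x' : E.total} (hq : Hom.fn E.proj x = Hom.fn E.proj x')
    (hv : vert E x = vert E x') : x = x' := by
  obtain ⟨t, ht, ht'⟩ := exists_of_isPullback E.bundle.sq x x rfl
  obtain ⟨s, hs, hs'⟩ := exists_of_isPullback E.bundle.sq x' x hq.symm
  have : t = s := by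
    refine eq_of_isPullback (E.universal.isPullback 0) ?_ ?_
    · change Hom.fn E.proj (Hom.fn E.bundle.fst t) = Hom.fn E.proj (Hom.fn E.bundle.fst s)
      rw [ht, hs, hq]
    · refine (fn_universal E t).trans (Eq.trans ?_ (fn_universal E s).symm)
      rw [ht, ht', hs, hs', hv]
  rw [← ht, this, hs]

/-- By uniqueness in the fibre over `0`, the idempotent `D` is the identity on `ker q`. -/
theorem vert_eq_self {k : E.total} (hk : Hom.fn E.proj k = 0) : vert E k = k :=
  vert_injOn_fiber E ((proj_vert E k).trans hk.symm) (vert_vert E k)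

/-! ### The unit and the counit -/

/-- The kernel of the projection of `E`, as a `U(A)`-module through the zero section. -/
abbrev ker : A.UMod := kerModule E.proj E.bundle.zero

/-- The vertical derivation with values in the kernel of the projection. -/
def vertKer (e : E.total) : ker E := ⟨vert E e, proj_vert E e⟩

/-- The morphism `e ↦ (q e, D e)`. -/
def toSemidirectKer : E.total ⟶ A.semidirect (ker E) :=
  mkHom (B := A.semidirect (ker E))
    (fun e => (⟨Hom.fn E.proj e, vertKer E e⟩ : Semidirect (ker E)))
    (fun c e => Semidirect.ext (fn_smul E.proj c e) (Subtype.ext (vert_smul E c e)))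
    (fun e e' => Semidirect.ext (fn_add E.proj e e') (Subtype.ext (vert_add E e e')))
    (fun e e' => Semidirect.ext (fn_mul E.proj e e') (Subtype.ext (vert_mul E e e')))
    (fun n e => by
      rw [dpow_semidirect]
      refine Semidirect.ext (fn_dpow E.proj (n + 1) e) (Subtype.ext ((vert_dpow E n e).trans ?_))
      exact (dpAct_compat (ker E) (AlgMod.regular F E.total) (Hom.fn E.bundle.zero)
        (fun k => k.1) (fn_dpow E.bundle.zero) (fun _ _ => rfl) n (Hom.fn E.proj e)
        (vertKer E e)).symm)

theorem toSemidirectKer_bijective : Function.Bijective (Hom.fn (toSemidirectKer E)) := by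
  constructor
  · intro e e' h
    exact vert_injOn_fiber E (congrArg (Semidirect.fst (M := ker E)) h)
      (congrArg Subtype.val (congrArg (Semidirect.snd (M := ker E)) h))
  · rintro ⟨a, ⟨k, hk⟩⟩
    have hk' : Hom.fn E.proj k = 0 := hk
    refine ⟨Hom.fn E.bundle.zero a + k, Semidirect.ext ?_ (Subtype.ext ?_)⟩
    · change Hom.fn E.proj (Hom.fn E.bundle.zero a + k) = a
      rw [fn_add, proj_zero, hk', add_zero]
    · change vert E (Hom.fn E.bundle.zero a + k) = k
      rw [vert_add, vert_zero, zero_add, vert_eq_self E hk']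

/-- `e ↦ (q e, D e)` as a morphism of differential bundles. -/
def unitHom : E ⟶ A.semidirectFunctor.obj (A.kerFunctor.obj E) where
  map := toSemidirectKer E
  map_proj := rfl
  map_lift := hom_ext fun e => by
    change tpair (A := A.semidirect (ker E)) (⟨Hom.fn E.proj e, 0⟩ : Semidirect (ker E))
        (⟨0, vertKer E e⟩ : Semidirect (ker E)) =
      Hom.fn ((tangentFunctor F).map (toSemidirectKer E)) (Hom.fn E.lift e)
    rw [fn_lift]
    refine tangent_ext (Semidirect.ext (proj_zero E _).symm (Subtype.ext (vert_zero E _).symm))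
      (Semidirect.ext (proj_vert E e).symm (Subtype.ext (vert_vert E e).symm))

theorem isIso_unitHom : IsIso (unitHom E) :=
  have : IsIso (DifferentialBundle.Hom.map (unitHom E)) :=
    isIso_of_bijective _ (toSemidirectKer_bijective E)
  DifferentialBundle.isIso_of_isIso_map _

end Vert

variable (A : DivPowAlg.{v, u} F)

/-- Every differential bundle `E` over `A` is naturally isomorphic to `A ⋉_p ker q`. -/
noncomputable def unitIso : 𝟭 A.DBun ≅ A.kerFunctor ⋙ A.semidirectFunctor :=
  NatIso.ofComponents (fun E => @asIso _ _ _ _ (unitHom E) (isIso_unitHom E)) fun {E E'} f => by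
    refine DifferentialBundle.hom_ext (hom_ext fun e => Semidirect.ext ?_ (Subtype.ext ?_))
    · exact congrArg (fun k => Hom.fn k e) (DifferentialBundle.Hom.map_proj f)
    · exact congrArg (fun k => tsnd (Hom.fn k e)) (DifferentialBundle.Hom.map_lift f)

/-- The kernel of `A ⋉_p M ⟶ A` is naturally isomorphic to `M`. -/
def counitIso : A.semidirectFunctor ⋙ A.kerFunctor ≅ 𝟭 A.UMod :=
  NatIso.ofComponents (fun M =>
    { hom :=
        { toLin :=
            { toFun := fun k => Semidirect.snd (M := M) k.1
              map_add' := fun _ _ => rfl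
              map_smul' := fun _ _ => rfl }
          map_act := fun a k => by
            change M.act a (Semidirect.snd (M := M) k.1) +
              M.act (Semidirect.fst (M := M) k.1) 0 = M.act a (Semidirect.snd (M := M) k.1)
            rw [map_zero, add_zero] }
      inv :=
        { toLin :=
            { toFun := fun m => ⟨(⟨0, m⟩ : Semidirect M), rfl⟩
              map_add' := fun _ _ => Subtype.ext (Semidirect.ext (add_zero (0 : A)).symm rfl)
              map_smul' := fun c _ => Subtype.ext (Semidirect.ext (smul_zero c).symm rfl) }
          map_act := fun a m => Subtype.ext (Semidirect.ext (mul_zero a).symm (by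
            change M.act a m = M.act a m + M.act 0 0
            rw [map_zero, add_zero])) }
      hom_inv_id := AlgMod.hom_ext fun k =>
        Subtype.ext (Semidirect.ext (Eq.symm (k.2 : Semidirect.fst (M := M) k.1 = 0)) rfl)
      inv_hom_id := rfl }) fun _ => rfl

end DivPowAlg

theorem mainTheorem5 {F : Type v} [Field F] (A : DivPowAlg.{v, u} F) :
    ∃ e : A.DBun ≌ A.UMod, e.functor = A.kerFunctor ∧ e.inverse = A.semidirectFunctor :=
  ⟨CategoryTheory.Equivalence.mk A.kerFunctor A.semidirectFunctor A.unitIso A.counitIso, rfl, rfl⟩
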